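/- Let $U=\{(\alpha,\beta)\in\mathbb R^2 : 0\le\beta\le\alpha\le 1\}$, with interior $U^\circ$ in $\mathbb R^2$. For $(\alpha,\beta)\in U^\circ$ let $T_{\alpha,\beta}:[0,1)\to[0,1)$ be the interval translation mapping $$T_{\alpha,\beta}(x)=\begin{cases}x+\alpha & \text{if } x\in[0,1-\alpha),\\ x+\beta & \text{if } x\in[1-\alpha,1-\beta),\\ x+\beta-1 & \text{if } x\in[1-\beta,1),\end{cases}$$ and let $$G(\alpha,\beta)=\Big(\frac{\beta}{\alpha},\ \frac{\beta-1}{\alpha}+\Big\lfloor\frac1\alpha\Big\rfloor\Big).$$ Let $A=\bigcap_{n\ge0}G^{-n}(U^\circ)$ be the set of $(\alpha,\beta)\in U^\circ$ all of whose iterates $G^n(\alpha,\beta)$, $n\ge 0$, lie in $U^\circ$. Call $T_{\alpha,\beta}$ uniquely ergodic if it has exactly one invariant Borel probability measure, and put $$A_{UE}=\{(\alpha,\beta)\in A : T_{\alpha,\beta}\text{ is uniquely ergodic}\}.$$ Then $A_{UE}$ is a dense $G_\delta$ set in $A$ (with the subspace topology). Moreover, for each compact set $K\subset A$ the set $A_{UE}\cap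 K$ is a $G_\delta$ set, and each compact subset of $A$ is contained in a compact set $K\subset A$ for which $A_{UE}\cap K$ is dense in $K$. -/

import Mathlib

open Set MeasureTheory

noncomputable section

namespace ITM

/-- The triangle `U = {(α, β) : 0 ≤ β ≤ α ≤ 1}`. -/
def U : Set (ℝ × ℝ) := {p | 0 ≤ p.2 ∧ p.2 ≤ p.1 ∧ p.1 ≤ 1}

theorem mem_interior_U {p : ℝ × ℝ} : p ∈ interior U ↔ 0 < p.2 ∧ p.2 < p.1 ∧ p.1 < 1 := by
  constructor
  · intro h
    obtain ⟨ε, hε, hb⟩ := Metric.isOpen_iff.1 isOpen_interior p h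
    have key : ∀ a b : ℝ, |a| < ε → |b| < ε → (p.1 + a, p.2 + b) ∈ U := by
      intro a b ha hb'
      apply interior_subset
      apply hb
      rw [Metric.mem_ball, Prod.dist_eq, Real.dist_eq, Real.dist_eq]
      simpa using ⟨ha, hb'⟩
    have h0 : |(0 : ℝ)| < ε := by simpa using hε
    have h1 : |ε / 2| < ε := by rw [abs_of_pos (by linarith)]; linarith
    have h2 : |-(ε / 2)| < ε := by rw [abs_neg]; exact h1
    have k1 := (key 0 (-(ε / 2)) h0 h2).1
    have k2 := (key 0 (ε / 2) h0 h1).2.1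
    have k3 := (key (ε / 2) 0 h1 h0).2.2
    simp only at k1 k2 k3
    refine ⟨by linarith, by linarith, by linarith⟩
  · intro h
    have ho : IsOpen {q : ℝ × ℝ | 0 < q.2 ∧ q.2 < q.1 ∧ q.1 < 1} :=
      (isOpen_lt continuous_const continuous_snd).inter
        ((isOpen_lt continuous_snd continuous_fst).inter
          (isOpen_lt continuous_fst continuous_const))
    have hs : {q : ℝ × ℝ | 0 < q.2 ∧ q.2 < q.1 ∧ q.1 < 1} ⊆ U :=
      fun q hq => ⟨hq.1.le, hq.2.1.le, hq.2.2.le⟩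
    exact interior_maximal hs ho h

/-- The formula of the interval translation mapping `T_{α,β}`, on `[0, 1)`. -/
def formula (α β x : ℝ) : ℝ :=
  if x < 1 - α then x + α else if x < 1 - β then x + β else x + β - 1

theorem formula_mem {p : ℝ × ℝ} (hp : p ∈ interior U) {x : ℝ} (hx : x ∈ Ico (0 : ℝ) 1) :
    formula p.1 p.2 x ∈ Ico (0 : ℝ) 1 := by
  obtain ⟨h1, h2, h3⟩ := mem_interior_U.1 hp
  obtain ⟨hx0, hx1⟩ := hx
  unfold formula
  split_ifs <;> constructor <;> linarith

/-- The interval translation mapping `T_{α,β} : [0, 1) → [0, 1)` for `(α, β)` in the interior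
of `U`. -/
def T (p : ↥(interior U)) (x : ↥(Ico (0 : ℝ) 1)) : ↥(Ico (0 : ℝ) 1) :=
  ⟨formula p.1.1 p.1.2 x, formula_mem p.2 x.2⟩

/-- The Gauss map `G(α, β) = (β / α, (β - 1) / α + ⌊1 / α⌋)`; it is only ever applied on
the interior of `U`. -/
def G (p : ℝ × ℝ) : ℝ × ℝ := (p.2 / p.1, (p.2 - 1) / p.1 + (⌊1 / p.1⌋ : ℝ))

/-- The set `A = ⋂_{n ≥ 0} G⁻ⁿ(U°)`: all iterates `Gⁿ(α, β)`, `n ≥ 0`, lie in the interior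
of `U`. -/
def A : Set (ℝ × ℝ) := ⋂ n : ℕ, G^[n] ⁻¹' interior U

theorem A_subset : A ⊆ interior U := fun _ hp => mem_iInter.1 hp 0

/-- A map is uniquely ergodic if it has exactly one invariant probability measure. -/
def UniquelyErgodic {X : Type*} [MeasurableSpace X] (S : X → X) : Prop :=
  ∃! μ : Measure X, IsProbabilityMeasure μ ∧ MeasurePreserving S μ μ

/-- The set of `(α, β) ∈ A` for which `T_{α,β}` is uniquely ergodic. -/
def AUE : Set (ℝ × ℝ) := {p | ∃ hp : p ∈ A, UniquelyErgodic (T ⟨p, A_subset hp⟩)}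

end ITM

end

/-!
The first return map of `T p` to `[1 - α, 1)` is a rescaled copy of `T (G p)`. Hence a parameter
of infinite type is governed by its sequence of partial quotients `k n = ⌊1 / α n⌋`, in two ways.

On the side of parameters, the barycentric coordinates of `p` and `G p` in the triangle are related
by a nonnegative matrix `paramMat (k 0)`. For infinite type parameters partial quotients `≥ 2`
occur infinitely often at indices of both parities (`exists_two_le_digits`), hence infinitely often
two of them enclose an even number of ones, and such blocks contract projectively by a factor
that is uniform in their length and in the quotients (`balancedBlock_paramMat`). Therefore a
parameter in `A` is the limit of the cells of parameters sharing its first partial quotients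
(`exists_forall_dist_lt`).

On the side of measures, an invariant measure is described by its distribution function
`F x = μ [0, x)`, which is a fixed point of `transfer p`. Such an `F` is the lift `towerLift` of an
invariant distribution function for `G p`, and the masses of the three continuity intervals are
related by the matrix `massMat (k 0)`. Lifting does not increase the uniform distance of two
distribution functions with the same masses (`Renorm.abs_towerLift_le`), and the total mass at level
`n` tends to `0` (`tendsto_sum_vecs`). So an invariant distribution function is determined by its
masses (`eq_of_mass_eq`), and each vector in the intersection `massVectors k` of the nested
simplices is realised by a uniform limit of lifts (`exists_invariant_dist`). Thus `T p` is uniquely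
ergodic if and only if this intersection is a point (`uniquelyErgodic_iff`).

By compactness, being a point is a countable intersection of conditions on finitely many partial
quotients, which are locally constant on `A`; this gives the `Gδ` property. If the partial quotients
are eventually `2`, then the mass matrices contract projectively and the intersection is a point
(`mem_AUE_of_digits_eq_two`). Replacing the partial quotients of the points of a set `K` by `2` from
index `n` on gives parameters close to `K`, which proves density; for compact `K` there are only
finitely many of them for each `n`, and they accumulate only on `K`, so that they form a compact
set together with `K` (`isCompact_union_truncations`).
-/

noncomputable section

namespace ITM

open Matrix Filter Topology

/-! ### Projective contraction of products of nonnegative matrices -/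

section Ray

variable {ι : Type*} [Fintype ι]

/-- The sequence `x` satisfies the backward recursion `x n = M n *ᵥ x (n + 1)` up to level `N`. -/
def RecTo (M : ℕ → Matrix ι ι ℝ) (N : ℕ) (x : ℕ → ι → ℝ) : Prop :=
  ∀ n < N, x n = M n *ᵥ x (n + 1)

variable {M : ℕ → Matrix ι ι ℝ}

theorem RecTo.mono {N N' : ℕ} {x : ℕ → ι → ℝ} (h : RecTo M N x) (hN : N' ≤ N) : RecTo M N' x :=
  fun n hn => h n (hn.trans_le hN)

theorem RecTo.sub_smul {N : ℕ} {x y : ℕ → ι → ℝ} (hx : RecTo M N x) (hy : RecTo M N y) (a b : ℝ) :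
    RecTo M N (fun n => a • x n - b • y n) := by
  intro n hn
  simp only [mulVec_sub, mulVec_smul]
  rw [← hx n hn, ← hy n hn]

theorem mulVec_nonneg_of_nonneg {B : Matrix ι ι ℝ} (hB : ∀ i j, 0 ≤ B i j) {v : ι → ℝ}
    (hv : 0 ≤ v) : 0 ≤ B *ᵥ v :=
  fun i => Finset.sum_nonneg fun j _ => mul_nonneg (hB i j) (hv j)

theorem RecTo.nonneg (hM : ∀ n i j, 0 ≤ M n i j) {N : ℕ} {x : ℕ → ι → ℝ} (hx : RecTo M N x)
    (h : 0 ≤ x N) {n : ℕ} (hn : n ≤ N) : 0 ≤ x n := by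
  induction hn using Nat.decreasingInduction with
  | self => exact h
  | of_succ k hk ih =>
    rw [hx k hk]
    exact mulVec_nonneg_of_nonneg (hM k) ih

theorem RecTo.ne_zero {N : ℕ} {x : ℕ → ι → ℝ} (hx : RecTo M N x)
    {n n' : ℕ} (h : x n ≠ 0) (hn : n ≤ n') (hn' : n' ≤ N) : x n' ≠ 0 := by
  induction n', hn using Nat.le_induction with
  | base => exact h
  | succ k hk ih =>
    intro h0
    apply ih (by omega)
    rw [hx k (by omega), h0, mulVec_zero]

/-- The product `M n * ⋯ * M (n' - 1)` maps the positive orthant to a set of projective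
diameter at most `log C`: ratios of coordinates of any two image vectors agree up to the
factor `C`. -/
def BalancedBlock (M : ℕ → Matrix ι ι ℝ) (C : ℝ) (n n' : ℕ) : Prop :=
  n ≤ n' ∧ ∀ u v : ℕ → ι → ℝ, RecTo M n' u → RecTo M n' v → 0 ≤ u n' → 0 ≤ v n' →
    ∀ i j, u n i * v n j ≤ C * (u n j * v n i)

/-- Any two nonnegative orbits of sufficiently long finite length are proportional at level `n`
up to the relative error `c`. -/
def ProportionalUpTo (M : ℕ → Matrix ι ι ℝ) (n : ℕ) (c : ℝ) : Prop :=
  ∃ N, n ≤ N ∧ ∀ x y : ℕ → ι → ℝ, RecTo M N x → RecTo M N y → 0 ≤ x N → 0 ≤ y N → y n ≠ 0 →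
    ∃ t T : ℝ, 0 ≤ t ∧ t • y n ≤ x n ∧ x n ≤ T • y n ∧ T - t ≤ c * t

theorem ProportionalUpTo.pred (hM : ∀ n i j, 0 ≤ M n i j) {n n' : ℕ} {c : ℝ}
    (h : ProportionalUpTo M n' c) (hn : n ≤ n') : ProportionalUpTo M n c := by
  obtain ⟨N, hN, h⟩ := h
  refine ⟨N, hn.trans hN, fun x y hx hy hx0 hy0 hne => ?_⟩
  obtain ⟨t, T, ht, h1, h2, h3⟩ := h x y hx hy hx0 hy0 (hy.ne_zero hne hn hN)
  refine ⟨t, T, ht, ?_, ?_, h3⟩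
  · have := RecTo.nonneg hM ((hx.sub_smul hy 1 t).mono hN) (by simpa using h1) hn
    simpa using this
  · have := RecTo.nonneg hM ((hy.sub_smul hx T 1).mono hN) (by simpa using h2) hn
    simpa using this

theorem BalancedBlock.proportionalUpTo (hM : ∀ n i j, 0 ≤ M n i j) {C : ℝ} (hC : 1 ≤ C)
    {n n' : ℕ} (h : BalancedBlock M C n n') : ProportionalUpTo M n (C ^ 2) := by
  refine ⟨n', h.1, fun x y hx hy hx0 hy0 hne => ?_⟩
  have hxn := hx.nonneg hM hx0 h.1
  have hyn := hy.nonneg hM hy0 h.1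
  obtain ⟨j, hj⟩ : ∃ j, y n j ≠ 0 := by
    by_contra! hcon
    exact hne (funext hcon)
  have hj : 0 < y n j := lt_of_le_of_ne (hyn j) (Ne.symm hj)
  have hr : 0 ≤ x n j / y n j := div_nonneg (hxn j) hj.le
  refine ⟨x n j / y n j / C, C * (x n j / y n j), by positivity, fun i => ?_, fun i => ?_, ?_⟩
  · have := h.2 x y hx hy hx0 hy0 j i
    simp only [Pi.smul_apply, smul_eq_mul]
    rw [div_div, div_mul_eq_mul_div, div_le_iff₀ (by positivity)]
    linarith
  · have := h.2 x y hx hy hx0 hy0 i j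
    simp only [Pi.smul_apply, smul_eq_mul]
    rw [mul_div_assoc', div_mul_eq_mul_div, le_div_iff₀ hj]
    linarith
  · have h1 : 0 ≤ x n j / y n j / C := by positivity
    have : C ^ 2 * (x n j / y n j / C) = C * (x n j / y n j) := by
      field_simp
    linarith

/-- A balanced block improves the proportionality of two orbits by a fixed factor. -/
theorem BalancedBlock.contract {C : ℝ} (hM : ∀ n i j, 0 ≤ M n i j) (hC : 1 ≤ C)
    {n n' : ℕ} {c : ℝ} (hc : 0 ≤ c) (hB : BalancedBlock M C n n')
    (h : ProportionalUpTo M n' c) : ProportionalUpTo M n ((1 - 1 / (2 * C)) * c) := by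
  obtain ⟨N, hN, h⟩ := h
  refine ⟨N, hB.1.trans hN, fun x y hx hy hx0 hy0 hne => ?_⟩
  obtain ⟨t, T, ht, h1, h2, h3⟩ := h x y hx hy hx0 hy0 (hy.ne_zero hne hB.1 hN)
  have hyn := hy.nonneg hM hy0 (hB.1.trans hN)
  have hyn' := hy.nonneg hM hy0 hN
  have hu : RecTo M n' (fun n => (1 : ℝ) • x n - t • y n) := (hx.sub_smul hy 1 t).mono hN
  have hw : RecTo M n' (fun n => T • y n - (1 : ℝ) • x n) := (hy.sub_smul hx T 1).mono hN
  have hu0 := hu.nonneg hM (by simpa using h1) hB.1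
  have hw0 := hw.nonneg hM (by simpa using h2) hB.1
  have hδ : 1 / (2 * C) ≤ 1 / 2 := by
    apply one_div_le_one_div_of_le <;> linarith
  have hδ0 : 0 < 1 / (2 * C) := by positivity
  set δ := 1 / (2 * C) with hδdef
  have hTt : 0 ≤ T - t := by
    obtain ⟨j, hj⟩ : ∃ j, y n j ≠ 0 := by
      by_contra! hcon
      exact hne (funext hcon)
    have hj : 0 < y n j := lt_of_le_of_ne (hyn j) (Ne.symm hj)
    have a1 := hu0 j
    have a2 := hw0 j
    simp at a1 a2
    nlinarith
  -- either `x - t • y` has a share of at least one half of `(T - t) • y` in some coordinate, and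
  -- then a definite share in all of them, or `T • y - x` has such a share in all coordinates
  by_cases hcase : ∃ i, 0 < y n i ∧ (T - t) / 2 * y n i ≤ x n i - t * y n i
  · obtain ⟨i, hi, hi2⟩ := hcase
    refine ⟨t + δ * (T - t), T, by positivity, fun j => ?_, by simpa using hw0, ?_⟩
    · have := hB.2 _ y hu (hy.mono hN) (by simpa using h1) hyn' i j
      simp only [Pi.smul_apply, Pi.sub_apply, smul_eq_mul, one_mul] at this ⊢
      have h4 : (T - t) / 2 * y n i * y n j ≤ (x n i - t * y n i) * y n j :=
        mul_le_mul_of_nonneg_right hi2 (hyn j)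
      have h5 : (T - t) / 2 * y n j ≤ C * (x n j - t * y n j) := by
        refine le_of_mul_le_mul_right ?_ hi
        linarith
      have h6 : δ * (T - t) * y n j ≤ x n j - t * y n j := by
        have : δ * (T - t) * y n j = (T - t) / 2 * y n j / C := by
          rw [hδdef]; field_simp
        rw [this, div_le_iff₀ (by positivity)]
        linarith
      linarith
    · have : 0 ≤ (1 - δ) * c * (δ * (T - t)) := by
        have : 0 ≤ 1 - δ := by linarith
        positivity
      nlinarith
  · push Not at hcase
    refine ⟨t, T - (T - t) / 2, ht, by simpa using hu0, fun j => ?_, ?_⟩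
    · simp only [Pi.smul_apply, smul_eq_mul]
      rcases (hyn j).lt_or_eq with hj | hj
      · have := hcase j hj
        linarith
      · have a2 := hw0 j
        simp only [Pi.smul_apply, Pi.sub_apply, smul_eq_mul, one_mul] at a2
        simp only [Pi.zero_apply] at hj a2
        rw [← hj] at a2 ⊢
        linarith
    · have : 0 ≤ c * t := by positivity
      nlinarith

/-- If balanced blocks with the same constant occur infinitely often, nonnegative orbits of the
recursion are asymptotically proportional. -/
theorem proportionalUpTo_of_frequently {C : ℝ} (hM : ∀ n i j, 0 ≤ M n i j) (hC : 1 ≤ C)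
    (hB : ∀ m, ∃ n n', m ≤ n ∧ BalancedBlock M C n n') {ε : ℝ} (hε : 0 < ε) :
    ProportionalUpTo M 0 ε := by
  have hδ0 : 0 < 1 / (2 * C) := by positivity
  have hδ : 1 / (2 * C) ≤ 1 / 2 := by
    apply one_div_le_one_div_of_le <;> linarith
  have key : ∀ j n, ProportionalUpTo M n ((1 - 1 / (2 * C)) ^ j * C ^ 2) := by
    intro j
    induction j with
    | zero =>
      intro n
      obtain ⟨a, b, hab, hblock⟩ := hB n
      simpa using (hblock.proportionalUpTo hM hC).pred hM hab
    | succ j ih =>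
      intro n
      obtain ⟨a, b, hab, hblock⟩ := hB n
      have hpos : 0 ≤ (1 - 1 / (2 * C)) ^ j * C ^ 2 :=
        mul_nonneg (pow_nonneg (by linarith) _) (by positivity)
      have := (hblock.contract hM hC hpos (ih b)).pred hM hab
      rwa [← mul_assoc, ← pow_succ'] at this
  have hlim : Filter.Tendsto (fun j : ℕ => (1 - 1 / (2 * C)) ^ j * C ^ 2) Filter.atTop
      (nhds (0 * C ^ 2)) :=
    (tendsto_pow_atTop_nhds_zero_of_lt_one (by linarith) (by linarith)).mul_const _
  rw [zero_mul] at hlim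
  obtain ⟨j, hj⟩ := (hlim.eventually (gt_mem_nhds hε)).exists
  obtain ⟨N, hN, h⟩ := key j 0
  refine ⟨N, hN, fun x y hx hy hx0 hy0 hne => ?_⟩
  obtain ⟨t, T, ht, h1, h2, h3⟩ := h x y hx hy hx0 hy0 hne
  exact ⟨t, T, ht, h1, h2, h3.trans (by gcongr)⟩

/-- Nonnegative orbits normalised at level `0` are uniformly close there once they are long. -/
theorem exists_forall_abs_sub_le {C : ℝ} (hM : ∀ n i j, 0 ≤ M n i j) (hC : 1 ≤ C)
    (hB : ∀ m, ∃ n n', m ≤ n ∧ BalancedBlock M C n n') {ε : ℝ} (hε : 0 < ε) :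
    ∃ N, ∀ x y : ℕ → ι → ℝ, RecTo M N x → RecTo M N y → 0 ≤ x N → 0 ≤ y N →
      ∑ i, x 0 i = 1 → ∑ i, y 0 i = 1 → ∀ i, |x 0 i - y 0 i| ≤ ε := by
  obtain ⟨N, -, h⟩ := proportionalUpTo_of_frequently hM hC hB hε
  refine ⟨N, fun x y hx hy hx0 hy0 hx1 hy1 i => ?_⟩
  have hne : y 0 ≠ 0 := by
    intro h0
    simp [h0] at hy1
  obtain ⟨t, T, ht, h1, h2, h3⟩ := h x y hx hy hx0 hy0 hne
  have hyn := hy.nonneg hM hy0 (Nat.zero_le N)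
  have ht1 : t ≤ 1 := by
    have : ∑ i, t * y 0 i ≤ ∑ i, x 0 i := Finset.sum_le_sum fun i _ => h1 i
    rwa [← Finset.mul_sum, hx1, hy1, mul_one] at this
  have hT1 : 1 ≤ T := by
    have : ∑ i, x 0 i ≤ ∑ i, T * y 0 i := Finset.sum_le_sum fun i _ => h2 i
    rwa [← Finset.mul_sum, hx1, hy1, mul_one] at this
  have hyi : y 0 i ≤ 1 := by
    rw [← hy1]
    exact Finset.single_le_sum (fun j _ => hyn j) (Finset.mem_univ i)
  have a1 := h1 i
  have a2 := h2 i
  have a0 := hyn i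
  simp only [Pi.smul_apply, smul_eq_mul, Pi.zero_apply] at a1 a2 a0
  have h4 : T - t ≤ ε := h3.trans (by nlinarith)
  rw [abs_le]
  constructor <;> nlinarith

end Ray

/-! ### Partial quotients and inverse branches of the Gauss map -/

/-- The first partial quotient `⌊1 / α⌋` of the parameter `(α, β)`. -/
def digit (p : ℝ × ℝ) : ℕ := ⌊1 / p.1⌋₊

/-- The sequence of partial quotients of the parameter `p`. -/
def digits (p : ℝ × ℝ) (n : ℕ) : ℕ := digit (G^[n] p)

theorem digits_succ (p : ℝ × ℝ) (n : ℕ) : digits p (n + 1) = digits (G p) n := rfl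

/-- The parameter `q` is the image under `G` of `p`, with partial quotient `k`; the relations
express `p` through `q` without division. -/
structure Renorm (k : ℕ) (p q : ℝ × ℝ) : Prop where
  fst_mul : p.1 * (k + q.1 - q.2) = 1
  snd_eq : p.2 = p.1 * q.1
  one_le : 1 ≤ k
  snd_pos : 0 < q.2
  snd_lt : q.2 < q.1
  fst_lt : q.1 < 1

namespace Renorm

variable {k : ℕ} {p q : ℝ × ℝ}

theorem one_le_cast (h : Renorm k p q) : (1 : ℝ) ≤ k := by exact_mod_cast h.one_le

theorem fst_pos (h : Renorm k p q) : 0 < p.1 := by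
  have h1 := h.fst_mul
  have := h.one_le_cast
  have := h.snd_lt
  by_contra hcon
  nlinarith

theorem inv_eq (h : Renorm k p q) : 1 / p.1 = k + q.1 - q.2 := by
  rw [div_eq_iff h.fst_pos.ne', mul_comm]
  exact h.fst_mul.symm

theorem fst_mem (h : Renorm k p q) : p.1 < 1 := by
  have h1 := h.fst_mul
  have := h.one_le_cast
  have := h.snd_lt
  have := h.fst_pos
  nlinarith

theorem mem_left (h : Renorm k p q) : p ∈ interior U := by
  rw [mem_interior_U]
  have h0 := h.fst_pos
  refine ⟨?_, ?_, h.fst_mem⟩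
  · rw [h.snd_eq]
    exact mul_pos h0 (h.snd_pos.trans h.snd_lt)
  · rw [h.snd_eq]
    nlinarith [h.fst_lt]

theorem mem_right (h : Renorm k p q) : q ∈ interior U :=
  mem_interior_U.2 ⟨h.snd_pos, h.snd_lt, h.fst_lt⟩

theorem digit_eq (h : Renorm k p q) : digit p = k := by
  unfold digit
  rw [h.inv_eq, Nat.floor_eq_iff (by linarith [h.one_le_cast, h.snd_lt])]
  constructor <;> linarith [h.snd_lt, h.snd_pos, h.fst_lt]

theorem G_eq (h : Renorm k p q) : G p = q := by
  have h0 := h.fst_pos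
  have hd : ((⌊1 / p.1⌋ : ℤ) : ℝ) = k := by
    have h1 : (⌊1 / p.1⌋ : ℤ) = (k : ℤ) := by
      rw [h.inv_eq, Int.floor_eq_iff]
      push_cast
      constructor <;> linarith [h.snd_lt, h.snd_pos, h.fst_lt]
    rw [h1]
    norm_cast
  unfold G
  rw [hd]
  ext
  · simp only
    rw [h.snd_eq]
    field_simp
  · simp only
    rw [h.snd_eq, sub_div, mul_div_cancel_left₀ _ h0.ne', h.inv_eq]
    ring

end Renorm

theorem renorm_of_mem {p : ℝ × ℝ} (hp : p ∈ interior U) (hG : G p ∈ interior U) :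
    Renorm (digit p) p (G p) := by
  obtain ⟨h1, h2, h3⟩ := mem_interior_U.1 hp
  obtain ⟨g1, g2, g3⟩ := mem_interior_U.1 hG
  have h0 : 0 < p.1 := h1.trans h2
  have hcast : ((⌊1 / p.1⌋ : ℤ) : ℝ) = (digit p : ℝ) := by
    unfold digit
    rw [natCast_floor_eq_intCast_floor (by positivity)]
  refine ⟨?_, ?_, ?_, g1, g2, g3⟩
  · unfold G
    simp only
    rw [hcast]
    field_simp
    ring
  · unfold G
    simp only
    field_simp
  · unfold digit
    rw [Nat.one_le_floor_iff, le_div_iff₀ h0]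
    linarith

theorem mem_A_iff {p : ℝ × ℝ} : p ∈ A ↔ ∀ n, G^[n] p ∈ interior U := by
  simp [A, mem_iInter]

theorem G_mem_A {p : ℝ × ℝ} (hp : p ∈ A) : G p ∈ A := by
  rw [mem_A_iff] at hp ⊢
  exact fun n => hp (n + 1)

theorem iterate_G_mem_A {p : ℝ × ℝ} (hp : p ∈ A) (n : ℕ) : G^[n] p ∈ A := by
  rw [mem_A_iff] at hp ⊢
  intro m
  rw [← Function.iterate_add_apply]
  exact hp _

theorem renorm_of_mem_A {p : ℝ × ℝ} (hp : p ∈ A) : Renorm (digit p) p (G p) :=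
  renorm_of_mem (A_subset hp) (A_subset (G_mem_A hp))

theorem Renorm.mem_A {k : ℕ} {p q : ℝ × ℝ} (h : Renorm k p q) (hq : q ∈ A) : p ∈ A := by
  rw [mem_A_iff] at hq ⊢
  intro n
  cases n with
  | zero => exact h.mem_left
  | succ n =>
    rw [Function.iterate_succ_apply, h.G_eq]
    exact hq n

/-- The inverse branch of `G` with partial quotient `k`. -/
def branch (k : ℕ) (q : ℝ × ℝ) : ℝ × ℝ := (1 / (k + q.1 - q.2), q.1 / (k + q.1 - q.2))

theorem renorm_branch {k : ℕ} (hk : 1 ≤ k) {q : ℝ × ℝ} (hq : q ∈ interior U) :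
    Renorm k (branch k q) q := by
  obtain ⟨h1, h2, h3⟩ := mem_interior_U.1 hq
  have hk' : (1 : ℝ) ≤ k := by exact_mod_cast hk
  have hpos : 0 < (k : ℝ) + q.1 - q.2 := by linarith
  refine ⟨?_, ?_, hk, h1, h2, h3⟩
  · simp only [branch]
    field_simp
  · simp only [branch]
    field_simp

/-! ### Continuity of the partial quotients -/

theorem continuousAt_G {p : ℝ × ℝ} (hp : p ∈ A) :
    ContinuousAt G p ∧ ∀ᶠ q in nhds p, digit q = digit p := by
  have hr := renorm_of_mem_A hp
  have h0 := hr.fst_pos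
  have hinv := hr.inv_eq
  have hc : ContinuousAt (fun q : ℝ × ℝ => 1 / q.1) p :=
    continuousAt_const.div continuousAt_fst h0.ne'
  have hev : ∀ᶠ q in nhds p, 1 / q.1 ∈ Ioo (digit p : ℝ) (digit p + 1) := by
    apply hc.eventually
    apply Ioo_mem_nhds
    · simp only [hinv]; linarith [hr.snd_lt]
    · simp only [hinv]; linarith [hr.snd_pos, hr.fst_lt]
  have hdig : ∀ᶠ q in nhds p, digit q = digit p := by
    filter_upwards [hev] with q hq
    have hq0 : (0 : ℝ) ≤ 1 / q.1 := le_trans (Nat.cast_nonneg _) hq.1.le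
    exact (Nat.floor_eq_iff hq0).2 ⟨hq.1.le, hq.2⟩
  refine ⟨?_, hdig⟩
  have hG : G =ᶠ[nhds p] fun q => (q.2 / q.1, (q.2 - 1) / q.1 + (digit p : ℝ)) := by
    filter_upwards [hev, hdig] with q hq hq2
    have hq0 : (0 : ℝ) ≤ 1 / q.1 := le_trans (Nat.cast_nonneg _) hq.1.le
    have : ((⌊1 / q.1⌋ : ℤ) : ℝ) = (digit p : ℝ) := by
      rw [← hq2]
      unfold digit
      rw [natCast_floor_eq_intCast_floor hq0]
    simp only [G, this]
  refine ContinuousAt.congr ?_ hG.symm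
  refine ContinuousAt.prodMk ?_ ?_
  · exact continuousAt_snd.div continuousAt_fst h0.ne'
  · exact ((continuousAt_snd.sub continuousAt_const).div continuousAt_fst h0.ne').add
      continuousAt_const

theorem continuousAt_iterate_G {p : ℝ × ℝ} (hp : p ∈ A) (n : ℕ) : ContinuousAt (G^[n]) p := by
  induction n with
  | zero => exact continuousAt_id
  | succ n ih =>
    rw [Function.iterate_succ']
    exact ContinuousAt.comp (continuousAt_G (iterate_G_mem_A hp n)).1 ih

theorem eventually_digits_eq {p : ℝ × ℝ} (hp : p ∈ A) (n : ℕ) :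
    ∀ᶠ q in nhds p, ∀ i < n, digits q i = digits p i := by
  refine (Filter.eventually_all_finite (Set.finite_lt_nat n)).2 fun i _ => ?_
  exact (continuousAt_iterate_G hp i).eventually (continuousAt_G (iterate_G_mem_A hp i)).2

/-! ### Partial quotients of infinite type parameters -/

/-- A partial quotient `1` moves the point away from the side `α = 1` two steps later. -/
theorem inv_one_sub_le {p : ℝ × ℝ} (hp : p ∈ A) (h : digit p = 1) :
    1 / (1 - (G^[2] p).1) ≤ 1 / (1 - p.1) - 1 := by
  have hr := renorm_of_mem_A hp
  have hr' := renorm_of_mem_A (G_mem_A hp)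
  rw [h] at hr
  change 1 / (1 - (G (G p)).1) ≤ _
  set q := G p
  set r := G q
  have e1 := hr.fst_mul
  have e2 := hr'.snd_eq
  have h1 := hr.fst_mem
  have h2 := hr'.fst_lt
  have h3 := hr.snd_lt
  have h4 := hr.fst_lt
  have h5 := hr.fst_pos
  have e3 : 1 / (1 - p.1) - 1 = 1 / (q.1 - q.2) := by
    have : q.1 - q.2 ≠ 0 := by linarith
    have : 1 - p.1 ≠ 0 := by linarith
    field_simp
    push_cast at e1
    linarith
  rw [e3]
  apply one_div_le_one_div_of_le
  · linarith
  · rw [e2]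
    nlinarith

theorem exists_two_le_digits {p : ℝ × ℝ} (hp : p ∈ A) (N : ℕ) :
    ∃ j, 2 ≤ digits p (N + 2 * j) := by
  by_contra! hcon
  have h1 : ∀ j, digits p (N + 2 * j) = 1 := by
    intro j
    have := (renorm_of_mem_A (iterate_G_mem_A hp (N + 2 * j))).one_le
    have := hcon j
    change 1 ≤ digits p (N + 2 * j) at *
    omega
  have key : ∀ j : ℕ, 1 / (1 - (G^[N + 2 * j] p).1) ≤ 1 / (1 - (G^[N] p).1) - j := by
    intro j
    induction j with
    | zero => simp
    | succ j ih =>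
      have h2 := inv_one_sub_le (iterate_G_mem_A hp (N + 2 * j)) (h1 j)
      rw [← Function.iterate_add_apply] at h2
      rw [show N + 2 * (j + 1) = 2 + (N + 2 * j) by ring]
      push_cast
      linarith
  obtain ⟨j, hj⟩ := exists_nat_gt (1 / (1 - (G^[N] p).1))
  have h3 := key j
  have h4 : 0 < 1 / (1 - (G^[N + 2 * j] p).1) := by
    have := (mem_interior_U.1 (mem_A_iff.1 hp (N + 2 * j))).2.2
    apply one_div_pos.2
    linarith
  linarith

/-- If large partial quotients occur infinitely often at indices of both parities, then
infinitely often two of them enclose a run of ones of even length. -/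
theorem exists_even_run {k : ℕ → ℕ} (hk1 : ∀ n, 1 ≤ k n) (hk : ∀ N, ∃ j, 2 ≤ k (N + 2 * j))
    (N : ℕ) : ∃ n j, N ≤ n ∧ 2 ≤ k n ∧ 2 ≤ k (n + 2 * j + 1) ∧
      ∀ i, 1 ≤ i → i ≤ 2 * j → k (n + i) = 1 := by
  have hex : ∃ j n, N ≤ n ∧ 2 ≤ k n ∧ 2 ≤ k (n + 2 * j + 1) := by
    obtain ⟨a, ha⟩ := hk N
    obtain ⟨b, hb⟩ := hk (N + 2 * a + 1)
    exact ⟨b, N + 2 * a, by omega, ha, by rwa [show N + 2 * a + 2 * b + 1 = N + 2 * a + 1 + 2 * b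
      by ring]⟩
  classical
  obtain ⟨n, hn, h1, h2⟩ := Nat.find_spec hex
  refine ⟨n, Nat.find hex, hn, h1, h2, fun i hi hi2 => ?_⟩
  by_contra hne
  have hki : 2 ≤ k (n + i) := by
    have := hk1 (n + i)
    omega
  rcases Nat.even_or_odd' i with ⟨c, rfl | rfl⟩
  · refine Nat.find_min hex (m := Nat.find hex - c) (by omega) ⟨n + 2 * c, by omega, hki, ?_⟩
    rwa [show n + 2 * c + 2 * (Nat.find hex - c) + 1 = n + 2 * Nat.find hex + 1 by omega]
  · exact Nat.find_min hex (m := c) (by omega) ⟨n, hn, h1, hki⟩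

/-! ### Cells of parameters -/

/-- The projective matrix of the inverse branches of `G`, in the barycentric coordinates
`(β, α - β, 1 - α)` of the triangle. -/
def paramMat (k : ℕ) : Matrix (Fin 3) (Fin 3) ℝ :=
  !![1, 1, 0; 0, 0, 1; (k : ℝ) - 1, k, (k : ℝ) - 1]

theorem paramMat_mulVec (k : ℕ) (v : Fin 3 → ℝ) :
    paramMat k *ᵥ v = ![v 0 + v 1, v 2, (k - 1) * (v 0 + v 1 + v 2) + v 1] := by
  ext i
  fin_cases i <;> simp [paramMat, mulVec, dotProduct, Fin.sum_univ_three]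
  ring

theorem paramMat_nonneg {k : ℕ} (hk : 1 ≤ k) (i j : Fin 3) : 0 ≤ paramMat k i j := by
  have : (1 : ℝ) ≤ k := by exact_mod_cast hk
  fin_cases i <;> fin_cases j <;> simp [paramMat] <;> linarith

/-- Barycentric coordinates in the triangle `U`. -/
def bary (p : ℝ × ℝ) : Fin 3 → ℝ := ![p.2, p.1 - p.2, 1 - p.1]

theorem Renorm.bary_eq {k : ℕ} {p q : ℝ × ℝ} (h : Renorm k p q) :
    bary p = p.1 • paramMat k *ᵥ bary q := by
  have h1 := h.fst_mul
  rw [paramMat_mulVec]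
  ext i
  fin_cases i <;> simp [bary, h.snd_eq]
  · ring
  · linarith

theorem bary_nonneg {p : ℝ × ℝ} (hp : p ∈ interior U) : 0 ≤ bary p := by
  obtain ⟨h1, h2, h3⟩ := mem_interior_U.1 hp
  intro i
  fin_cases i <;> simp [bary] <;> linarith

/-- The barycentric coordinates along the `G`-orbit of `p`, scaled so that they satisfy a linear
recursion. -/
def baryOrbit (p : ℝ × ℝ) (n : ℕ) : Fin 3 → ℝ :=
  (∏ i ∈ Finset.range n, (G^[i] p).1) • bary (G^[n] p)

theorem recTo_baryOrbit {p q : ℝ × ℝ} (hq : q ∈ A) {N : ℕ}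
    (h : ∀ i < N, digits q i = digits p i) :
    RecTo (fun n => paramMat (digits p n)) N (baryOrbit q) := by
  intro n hn
  have := (renorm_of_mem_A (iterate_G_mem_A hq n)).bary_eq
  simp only [baryOrbit]
  rw [this, Finset.prod_range_succ, mulVec_smul, ← Function.iterate_succ_apply' G, mul_smul,
    ← h n hn]
  rfl

theorem baryOrbit_nonneg {p : ℝ × ℝ} (hp : p ∈ A) (n : ℕ) : 0 ≤ baryOrbit p n := by
  refine smul_nonneg (Finset.prod_nonneg fun i _ => ?_) (bary_nonneg (mem_A_iff.1 hp n))
  obtain ⟨h1, h2, h3⟩ := mem_interior_U.1 (mem_A_iff.1 hp i)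
  linarith

theorem sum_baryOrbit_zero (p : ℝ × ℝ) : ∑ i, baryOrbit p 0 i = 1 := by
  simp [baryOrbit, bary, Fin.sum_univ_three]

/-- Vectors whose coordinates are comparable, up to the factor `K`, with a fixed profile have
coordinate ratios comparable up to the factor `K ^ 2`. -/
theorem mul_le_of_profile {r u v : Fin 3 → ℝ} {a b K : ℝ} (hr : 0 ≤ r) (ha : 0 ≤ a) (hb : 0 ≤ b)
    (hK : 0 ≤ K) (hu : ∀ i, r i * a ≤ u i ∧ u i ≤ K * (r i * a))
    (hv : ∀ i, r i * b ≤ v i ∧ v i ≤ K * (r i * b)) (i j : Fin 3) :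
    u i * v j ≤ K ^ 2 * (u j * v i) := by
  have p1 : 0 ≤ r i * a := mul_nonneg (hr i) ha
  have p2 : 0 ≤ r j * a := mul_nonneg (hr j) ha
  have p3 : 0 ≤ r i * b := mul_nonneg (hr i) hb
  have p4 : 0 ≤ r j * b := mul_nonneg (hr j) hb
  calc u i * v j ≤ (K * (r i * a)) * (K * (r j * b)) :=
        mul_le_mul (hu i).2 (hv j).2 (p4.trans (hv j).1) (mul_nonneg hK p1)
    _ = K ^ 2 * ((r j * a) * (r i * b)) := by ring
    _ ≤ K ^ 2 * (u j * v i) := by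
        gcongr
        · exact p2.trans (hu j).1
        · exact (hu j).1
        · exact (hv i).1

/-- The effect of an even number of partial quotients `1` is unipotent. -/
theorem run_of_ones {x : ℕ → Fin 3 → ℝ} {n : ℕ} (j : ℕ)
    (hx : ∀ i < 2 * j, x (n + i) = paramMat 1 *ᵥ x (n + i + 1)) :
    x n = ![x (n + 2 * j) 0 + j * (x (n + 2 * j) 1 + x (n + 2 * j) 2), x (n + 2 * j) 1,
      x (n + 2 * j) 2] := by
  induction j with
  | zero =>
    ext i
    fin_cases i <;> simp
  | succ j ih =>
    have h1 := hx (2 * j) (by omega)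
    have h2 := hx (2 * j + 1) (by omega)
    rw [show n + (2 * j + 1) = n + 2 * j + 1 by ring] at h2
    rw [h2] at h1
    rw [ih fun i hi => hx i (by omega), h1, show n + 2 * (j + 1) = n + 2 * j + 1 + 1 by ring]
    ext i
    fin_cases i <;> simp [paramMat_mulVec]
    ring

/-- A run of ones of even length between two larger partial quotients gives a uniformly
contracting product of parameter matrices, however long the run and large the quotients are. -/
theorem balancedBlock_paramMat {k : ℕ → ℕ} {n j : ℕ} (h1 : 2 ≤ k n) (h2 : 2 ≤ k (n + 2 * j + 1))
    (hrun : ∀ i, 1 ≤ i → i ≤ 2 * j → k (n + i) = 1) :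
    BalancedBlock (fun n => paramMat (k n)) (2 ^ 2) n (n + 2 * j + 2) := by
  refine ⟨by omega, ?_⟩
  obtain ⟨κ, hκ⟩ : ∃ κ : ℝ, κ = k n := ⟨_, rfl⟩
  obtain ⟨l, hl⟩ : ∃ l : ℝ, l = k (n + 2 * j + 1) := ⟨_, rfl⟩
  have hκ2 : 2 ≤ κ := by rw [hκ]; exact_mod_cast h1
  have hl2 : 2 ≤ l := by rw [hl]; exact_mod_cast h2
  have hj0 : (0 : ℝ) ≤ j := Nat.cast_nonneg j
  have hr : (0 : Fin 3 → ℝ) ≤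
      ![1 + j * (l - 1), l - 1, (κ - 1) * (1 + (j + 1) * (l - 1))] := by
    have : 0 ≤ (j : ℝ) * (l - 1) := mul_nonneg hj0 (by linarith)
    intro i
    fin_cases i <;> simp
    · linarith
    · linarith
    · exact mul_nonneg (by linarith) (by linarith)
  have key : ∀ u : ℕ → Fin 3 → ℝ, RecTo (fun n => paramMat (k n)) (n + 2 * j + 2) u →
      0 ≤ u (n + 2 * j + 2) → 0 ≤ ∑ i, u (n + 2 * j + 2) i ∧
      ∀ i, ![1 + j * (l - 1), l - 1, (κ - 1) * (1 + (j + 1) * (l - 1))] i *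
        (∑ i, u (n + 2 * j + 2) i) ≤ u n i ∧
        u n i ≤ 2 * (![1 + j * (l - 1), l - 1, (κ - 1) * (1 + (j + 1) * (l - 1))] i *
        (∑ i, u (n + 2 * j + 2) i)) := by
    intro u hu hpos
    have e1 := hu n (by omega)
    have e2 := hu (n + 2 * j + 1) (by omega)
    have e3 := run_of_ones (x := u) (n := n + 1) j (fun i hi => by
      have := hu (n + 1 + i) (by omega)
      rw [this, show n + 1 + i = n + (1 + i) by ring]
      simp only
      rw [hrun (1 + i) (by omega) (by omega)])
    rw [show n + 1 + 2 * j = n + 2 * j + 1 by ring, e2] at e3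
    rw [e3] at e1
    simp only [paramMat_mulVec, ← hκ, ← hl] at e1
    rw [show n + 2 * j + 1 + 1 = n + 2 * j + 2 by ring] at e1
    rw [e1]
    have b0 := hpos 0
    have b1 := hpos 1
    have b2 := hpos 2
    simp only [Fin.sum_univ_three]
    generalize u (n + 2 * j + 2) 0 = b at *
    generalize u (n + 2 * j + 2) 1 = d at *
    generalize u (n + 2 * j + 2) 2 = e at *
    generalize (j : ℝ) = J at *
    simp only [Pi.zero_apply] at b0 b1 b2
    refine ⟨by linarith, fun i => ?_⟩
    obtain ⟨l', rfl⟩ : ∃ l', l = l' + 2 := ⟨l - 2, by ring⟩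
    obtain ⟨κ', rfl⟩ : ∃ κ', κ = κ' + 2 := ⟨κ - 2, by ring⟩
    have hl' : 0 ≤ l' := by linarith
    have hκ' : 0 ≤ κ' := by linarith
    fin_cases i <;> simp <;> constructor <;> rw [← sub_nonneg] <;> ring_nf <;> positivity
  intro u v hu hv hu0 hv0 i j'
  obtain ⟨a0, au⟩ := key u hu hu0
  obtain ⟨c0, cv⟩ := key v hv hv0
  exact mul_le_of_profile hr a0 c0 zero_le_two au cv i j'

/-- Parameters that share sufficiently many partial quotients with `p` are close to `p`. -/
theorem exists_forall_dist_lt {p : ℝ × ℝ} (hp : p ∈ A) {ε : ℝ} (hε : 0 < ε) :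
    ∃ N, ∀ q ∈ A, (∀ i < N, digits q i = digits p i) → dist q p < ε := by
  have h1 : ∀ n, 1 ≤ digits p n := fun n => (renorm_of_mem_A (iterate_G_mem_A hp n)).one_le
  obtain ⟨N, hN⟩ := exists_forall_abs_sub_le (M := fun n => paramMat (digits p n)) (C := 2 ^ 2)
    (fun n => paramMat_nonneg (h1 n)) (by norm_num) (fun m => by
      obtain ⟨n, j, hn, a, b, c⟩ := exists_even_run h1 (exists_two_le_digits hp) m
      exact ⟨n, _, hn, balancedBlock_paramMat a b c⟩) (half_pos hε)
  refine ⟨N, fun q hq h => ?_⟩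
  have := hN _ _ (recTo_baryOrbit hq h) (recTo_baryOrbit hp fun _ _ => rfl)
    (baryOrbit_nonneg hq N) (baryOrbit_nonneg hp N) (sum_baryOrbit_zero q) (sum_baryOrbit_zero p)
  have a := this 0
  have b := this 2
  simp [baryOrbit, bary] at a b
  rw [Prod.dist_eq, max_lt_iff, Real.dist_eq, Real.dist_eq, abs_sub_comm q.1]
  constructor <;> linarith

/-- An infinite type parameter all of whose partial quotients are `2`. -/
theorem exists_digits_eq_two : ∃ q ∈ A, ∀ n, digits q n = 2 := by
  obtain ⟨a, ha, hroot⟩ : ∃ a ∈ Icc (0 : ℝ) 1, 2 * a + a ^ 2 - a ^ 3 = 1 := by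
    have := intermediate_value_Icc (f := fun a : ℝ => 2 * a + a ^ 2 - a ^ 3) zero_le_one
      (by fun_prop)
    exact this ⟨by norm_num, by norm_num⟩
  have ha0 : 0 < a := by
    rcases ha.1.lt_or_eq with h | h
    · exact h
    · rw [← h] at hroot; norm_num at hroot
  have ha1 : a < 1 := by
    rcases ha.2.lt_or_eq with h | h
    · exact h
    · rw [h] at hroot; norm_num at hroot
  have hr : Renorm 2 (a, a ^ 2) (a, a ^ 2) := by
    refine ⟨?_, ?_, by norm_num, by positivity, by nlinarith, ha1⟩
    · push_cast
      linarith
    · simp only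
      ring
  have hfix : ∀ n, G^[n] (a, a ^ 2) = (a, a ^ 2) := fun n =>
    Function.iterate_fixed hr.G_eq n
  refine ⟨(a, a ^ 2), mem_A_iff.2 fun n => ?_, fun n => ?_⟩
  · rw [hfix]; exact hr.mem_left
  · rw [digits, hfix]; exact hr.digit_eq

/-- Every finite block of partial quotients of an infinite type parameter can be continued by
twos only. -/
theorem exists_digits_eq_two_from {p : ℝ × ℝ} (hp : p ∈ A) (n : ℕ) :
    ∃ q ∈ A, (∀ i < n, digits q i = digits p i) ∧ ∀ i, n ≤ i → digits q i = 2 := by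
  induction n generalizing p with
  | zero =>
    obtain ⟨q, hq, h⟩ := exists_digits_eq_two
    exact ⟨q, hq, by simp, fun i _ => h i⟩
  | succ n ih =>
    obtain ⟨q, hq, h1, h2⟩ := ih (G_mem_A hp)
    have hr := renorm_branch (renorm_of_mem_A hp).one_le (A_subset hq)
    refine ⟨branch (digit p) q, hr.mem_A hq, fun i hi => ?_, fun i hi => ?_⟩
    · cases i with
      | zero => exact hr.digit_eq
      | succ i =>
        rw [digits_succ, hr.G_eq, digits_succ]
        exact h1 i (by omega)
    · cases i with
      | zero => omega
      | succ i =>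
        rw [digits_succ, hr.G_eq]
        exact h2 i (by omega)

/-! ### Distribution functions and renormalisation -/

/-- `F` vanishes to the left of `0` and is constant to the right of `1`, like the distribution
function of a signed measure on `[0, 1)`. -/
structure IsFlat (F : ℝ → ℝ) : Prop where
  zero : ∀ x ≤ 0, F x = 0
  one : ∀ x, 1 ≤ x → F x = F 1

/-- `F` is monotone, vanishes to the left of `0` and is constant to the right of `1`, like the
distribution function `x ↦ μ [0, x)` of a measure on `[0, 1)`. -/
structure IsDist (F : ℝ → ℝ) : Prop extends IsFlat F where
  mono : Monotone F

/-- If `F x = μ [0, x)` for a measure `μ` on `[0, 1)`, then `transfer p F` is the distribution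
function of the push-forward of `μ` under the interval translation mapping with parameter `p`. -/
def transfer (p : ℝ × ℝ) (F : ℝ → ℝ) (x : ℝ) : ℝ :=
  F (min x 1 - p.1) + (F (max (min x 1 - p.2) (1 - p.1)) - F (1 - p.1)) +
    (F (max x 0 + 1 - p.2) - F (1 - p.2))

/-- The distribution function, for parameter `p`, of the measure obtained from a measure with
distribution function `f`, for the renormalised parameter `q`, by placing it on `[1 - α, 1)` and
spreading it over the orbit segments up to the next return to `[1 - α, 1)`. -/
def towerLift (k : ℕ) (p q : ℝ × ℝ) (f : ℝ → ℝ) (x : ℝ) : ℝ :=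
  ∑ i ∈ Finset.range k,
    (f (1 - q.1 + max (min x (1 - p.1) - i * p.1) 0 / p.1) - f (1 - q.1)) +
      f ((x - 1 + p.1) / p.1)

/-- The masses of the three continuity intervals of the interval translation mapping. -/
def mass (p : ℝ × ℝ) (F : ℝ → ℝ) : Fin 3 → ℝ :=
  ![F (1 - p.1), F (1 - p.2) - F (1 - p.1), F 1 - F (1 - p.2)]

/-- The incidence matrix of the substitution `1 ↦ 2`, `2 ↦ 3 1ᵏ`, `3 ↦ 3 1ᵏ⁻¹` by which first
returns to `[1 - α, 1)` act on itineraries. -/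
def massMat (k : ℕ) : Matrix (Fin 3) (Fin 3) ℝ :=
  !![0, k, (k : ℝ) - 1; 1, 0, 0; 0, 1, 1]

theorem massMat_mulVec (k : ℕ) (v : Fin 3 → ℝ) :
    massMat k *ᵥ v = ![k * v 1 + (k - 1) * v 2, v 0, v 1 + v 2] := by
  ext i
  fin_cases i <;> simp [massMat, mulVec, dotProduct, Fin.sum_univ_three]

theorem massMat_nonneg {k : ℕ} (hk : 1 ≤ k) (i j : Fin 3) : 0 ≤ massMat k i j := by
  have : (1 : ℝ) ≤ k := by exact_mod_cast hk
  fin_cases i <;> fin_cases j <;> simp [massMat]; all_goals linarith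

section

variable {k : ℕ} {p q : ℝ × ℝ} {f g : ℝ → ℝ}

theorem IsFlat.sub (hf : IsFlat f) (hg : IsFlat g) : IsFlat (f - g) :=
  ⟨fun x hx => by simp [hf.zero x hx, hg.zero x hx],
    fun x hx => by simp [hf.one x hx, hg.one x hx]⟩

theorem IsDist.nonneg (hf : IsDist f) (x : ℝ) : 0 ≤ f x := by
  rcases le_total x 0 with h | h
  · exact (hf.zero x h).ge
  · rw [← hf.zero 0 le_rfl]
    exact hf.mono h

theorem IsDist.le_one (hf : IsDist f) (x : ℝ) : f x ≤ f 1 := by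
  rcases le_total x 1 with h | h
  · exact hf.mono h
  · exact (hf.one x h).le

theorem sum_mass (p : ℝ × ℝ) (f : ℝ → ℝ) : ∑ i, mass p f i = f 1 := by
  simp [mass, Fin.sum_univ_three]

theorem mass_sub (p : ℝ × ℝ) (f g : ℝ → ℝ) : mass p (f - g) = mass p f - mass p g := by
  ext i
  fin_cases i
  · simp [mass]
  · simp [mass]; ring
  · simp [mass]; ring

theorem IsDist.mass_nonneg (hp : p ∈ interior U) (hf : IsDist f) : 0 ≤ mass p f := by
  obtain ⟨h1, h2, h3⟩ := mem_interior_U.1 hp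
  intro i
  fin_cases i <;> simp [mass]
  · exact hf.nonneg _
  · exact hf.mono (by linarith)
  · exact hf.mono (by linarith)

theorem towerLift_sub (k : ℕ) (p q : ℝ × ℝ) (f g : ℝ → ℝ) :
    towerLift k p q (f - g) = towerLift k p q f - towerLift k p q g := by
  ext x
  simp only [towerLift, Pi.sub_apply, Finset.sum_sub_distrib]
  ring

/-- Summands of `towerLift` vanish below the corresponding floor of the tower. -/
theorem floor_empty {y : ℝ} (hy : y ≤ 0) :
    f (1 - q.1 + max y 0 / p.1) - f (1 - q.1) = 0 := by
  simp [max_eq_right hy]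

/-- Summands of `towerLift` are constant above the corresponding floor of the tower. -/
theorem Renorm.floor_full (h : Renorm k p q) (hf : IsFlat f) {y : ℝ} (hy : p.2 ≤ y) :
    f (1 - q.1 + max y 0 / p.1) - f (1 - q.1) = f 1 - f (1 - q.1) := by
  rw [hf.one]
  have h0 := h.fst_pos
  have : q.1 ≤ max y 0 / p.1 := by
    rw [le_div_iff₀ h0, mul_comm, ← h.snd_eq]
    exact le_max_of_le_left hy
  linarith

theorem Renorm.exists_succ (h : Renorm k p q) :
    ∃ j : ℕ, k = j + 1 :=
  ⟨k - 1, by have := h.one_le; omega⟩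

/-- All floors but the last one lie below `1 - α`. -/
theorem Renorm.le_sub_mul {j : ℕ} (h : Renorm (j + 1) p q) {i : ℕ} (hi : i < j) {x : ℝ}
    (hx : 1 - p.1 ≤ x) : p.2 ≤ x - i * p.1 := by
  have h0 := h.fst_pos
  have h1 := h.fst_mul
  have hi' : (i : ℝ) + 1 ≤ j := by exact_mod_cast hi
  push_cast at h1
  have h2 := h.snd_lt
  have h3 := h.fst_lt
  have h4 : p.1 * (i + 1) ≤ p.1 * j := mul_le_mul_of_nonneg_left hi' h0.le
  have h5 : p.1 * q.2 ≤ p.1 * q.1 := mul_le_mul_of_nonneg_left h2.le h0.le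
  have h6 : p.1 * q.1 ≤ p.1 * 1 := mul_le_mul_of_nonneg_left h3.le h0.le
  rw [h.snd_eq]
  linarith

theorem Renorm.last_floor {j : ℕ} (h : Renorm (j + 1) p q) :
    1 - p.1 - j * p.1 = p.1 * (q.1 - q.2) := by
  have h1 := h.fst_mul
  push_cast at h1
  linarith

/-- The total mass of the tower below `1 - α`. -/
theorem Renorm.sum_floors {j : ℕ} (h : Renorm (j + 1) p q) (hf : IsFlat f) :
    ∑ i ∈ Finset.range (j + 1), (f (1 - q.1 + max (1 - p.1 - i * p.1) 0 / p.1) - f (1 - q.1)) =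
      j * (f 1 - f (1 - q.1)) + (f (1 - q.2) - f (1 - q.1)) := by
  have h0 := h.fst_pos
  rw [Finset.sum_range_succ, Finset.sum_congr rfl fun i hi => h.floor_full hf
    (h.le_sub_mul (Finset.mem_range.1 hi) le_rfl), h.last_floor]
  have : max (p.1 * (q.1 - q.2)) 0 / p.1 = q.1 - q.2 := by
    rw [max_eq_left (mul_nonneg h0.le (by linarith [h.snd_lt])), mul_div_cancel_left₀ _ h0.ne']
  rw [this]
  simp
  ring

theorem Renorm.mass_towerLift (h : Renorm k p q) (hf : IsFlat f) :
    mass p (towerLift k p q f) = massMat k *ᵥ mass q f := by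
  obtain ⟨j, rfl⟩ := h.exists_succ
  have h0 := h.fst_pos
  have hp := mem_interior_U.1 h.mem_left
  have hα : towerLift (j + 1) p q f (1 - p.1) =
      j * (f 1 - f (1 - q.1)) + (f (1 - q.2) - f (1 - q.1)) := by
    simp only [towerLift, min_self]
    rw [h.sum_floors hf, hf.zero ((1 - p.1 - 1 + p.1) / p.1) (by simp), add_zero]
  have hge : ∀ x, 1 - p.1 ≤ x → towerLift (j + 1) p q f x =
      j * (f 1 - f (1 - q.1)) + (f (1 - q.2) - f (1 - q.1)) + f ((x - 1 + p.1) / p.1) := by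
    intro x hx
    simp only [towerLift, min_eq_right hx]
    rw [h.sum_floors hf]
  have e1 : (1 - p.2 - 1 + p.1) / p.1 = 1 - q.1 := by
    rw [h.snd_eq]; field_simp; ring
  have e2 : (1 - 1 + p.1) / p.1 = 1 := by simp [h0.ne']
  rw [massMat_mulVec]
  ext i
  fin_cases i <;> simp [mass]
  · rw [hα]; ring
  · rw [hα, hge _ (by linarith), e1]; ring
  · rw [hge 1 (by linarith), hge _ (by linarith), e1, e2]; ring

/-- Lifting along the tower does not increase the distance of the distribution functions of two
measures with the same masses: the floors are disjoint, so that each initial interval `[0, x)`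
cuts at most one of them. -/
theorem Renorm.abs_towerLift_le (h : Renorm k p q) (hf : IsFlat f) (hm : mass q f = 0) {c : ℝ}
    (hc : ∀ x, |f x| ≤ c) (x : ℝ) : |towerLift k p q f x| ≤ c := by
  obtain ⟨j, rfl⟩ := h.exists_succ
  have h0 := h.fst_pos
  have m0 : f (1 - q.1) = 0 := by simpa [mass] using congrFun hm 0
  have m1 : f (1 - q.2) = 0 := by simpa [mass, m0] using congrFun hm 1
  have m2 : f 1 = 0 := by simpa [mass, m1] using congrFun hm 2
  have hc0 : 0 ≤ c := (abs_nonneg _).trans (hc 0)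
  rcases le_total (1 - p.1) x with hx | hx
  · simp only [towerLift, min_eq_right hx]
    rw [h.sum_floors hf]
    simp only [m0, m1, m2, sub_self, mul_zero, add_zero, zero_add]
    exact hc _
  · simp only [towerLift, min_eq_left hx]
    rw [hf.zero ((x - 1 + p.1) / p.1) (div_nonpos_of_nonpos_of_nonneg (by linarith) h0.le),
      add_zero]
    by_cases hex : ∃ i ∈ Finset.range (j + 1), 0 < x - i * p.1 ∧ x - i * p.1 < p.2
    · obtain ⟨i, hi, h1, h2⟩ := hex
      rw [Finset.sum_eq_single_of_mem i hi]
      · rw [m0, sub_zero]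
        exact hc _
      · intro b _ hb
        have h3 := (mem_interior_U.1 h.mem_left).2.1
        rcases lt_or_gt_of_ne hb with hlt | hlt
        · have : (b : ℝ) + 1 ≤ i := by exact_mod_cast hlt
          rw [h.floor_full hf (by nlinarith), m2, m0, sub_zero]
        · have : (i : ℝ) + 1 ≤ b := by exact_mod_cast hlt
          exact floor_empty (by nlinarith)
    · push Not at hex
      rw [Finset.sum_eq_zero, abs_zero]
      · exact hc0
      · intro i hi
        rcases le_or_gt (x - i * p.1) 0 with h1 | h1
        · exact floor_empty h1
        · rw [h.floor_full hf (hex i hi h1), m2, m0, sub_zero]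

theorem Renorm.isFlat_towerLift (h : Renorm k p q) (hf : IsFlat f) :
    IsFlat (towerLift k p q f) := by
  have h0 := h.fst_pos
  have h1 := (mem_interior_U.1 h.mem_left).2.2
  refine ⟨fun x hx => ?_, fun x hx => ?_⟩
  · simp only [towerLift]
    rw [Finset.sum_eq_zero, hf.zero ((x - 1 + p.1) / p.1), add_zero]
    · exact div_nonpos_of_nonpos_of_nonneg (by linarith) h0.le
    · intro i _
      apply floor_empty
      have : (0 : ℝ) ≤ i * p.1 := by positivity
      linarith [min_le_left x (1 - p.1)]
  · simp only [towerLift]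
    rw [min_eq_right (by linarith), min_eq_right (by linarith), hf.one ((x - 1 + p.1) / p.1),
      hf.one ((1 - 1 + p.1) / p.1)]
    · simp [h0.ne']
    · rw [le_div_iff₀ h0]; linarith

theorem Renorm.isDist_towerLift (h : Renorm k p q) (hf : IsDist f) :
    IsDist (towerLift k p q f) := by
  have h0 := h.fst_pos
  refine ⟨h.isFlat_towerLift hf.toIsFlat, fun x y hxy => ?_⟩
  simp only [towerLift]
  gcongr ?_ + ?_
  · refine Finset.sum_le_sum fun i _ => sub_le_sub_right (hf.mono ?_) _
    gcongr
  · apply hf.mono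
    gcongr

theorem continuous_towerLift (hf : Continuous f) : Continuous (towerLift k p q f) := by
  unfold towerLift
  fun_prop

/-- Lifting along the tower transports the defect of invariance. -/
theorem Renorm.transfer_towerLift_sub (h : Renorm k p q) (hf : IsFlat f) (x : ℝ) :
    transfer p (towerLift k p q f) x - towerLift k p q f x =
      transfer q f ((x - 1 + p.1) / p.1) - f ((x - 1 + p.1) / p.1) := by
  obtain ⟨j, rfl⟩ := h.exists_succ
  have h0 := h.fst_pos
  obtain ⟨p1, p2, p3⟩ := mem_interior_U.1 h.mem_left
  obtain ⟨q1, q2, q3⟩ := mem_interior_U.1 h.mem_right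
  obtain ⟨t, ht⟩ : ∃ t, t = (x - 1 + p.1) / p.1 := ⟨_, rfl⟩
  have hxt : x = 1 - p.1 + p.1 * t := by rw [ht]; field_simp; ring
  -- below `1 - α` only the floors contribute, above it they all contribute their full mass
  have hlow : ∀ y, y ≤ 1 - p.1 → towerLift (j + 1) p q f y = ∑ i ∈ Finset.range (j + 1),
      (f (1 - q.1 + max (y - i * p.1) 0 / p.1) - f (1 - q.1)) := by
    intro y hy
    simp only [towerLift, min_eq_left hy]
    rw [hf.zero ((y - 1 + p.1) / p.1) (div_nonpos_of_nonpos_of_nonneg (by linarith) h0.le),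
      add_zero]
  have hhigh : ∀ y, 1 - p.1 ≤ y → towerLift (j + 1) p q f y =
      j * (f 1 - f (1 - q.1)) + (f (1 - q.2) - f (1 - q.1)) + f ((y - 1 + p.1) / p.1) := by
    intro y hy
    simp only [towerLift, min_eq_right hy]
    rw [h.sum_floors hf]
  have hthird : towerLift (j + 1) p q f (max x 0 + 1 - p.2) - towerLift (j + 1) p q f (1 - p.2) =
      f (1 - q.1 + max (min x 1) 0 / p.1) - f (1 - q.1) := by
    rw [hhigh _ (by linarith [le_max_right x 0]), hhigh _ (by linarith)]
    have e1 : (1 - p.2 - 1 + p.1) / p.1 = 1 - q.1 := by rw [h.snd_eq]; field_simp; ring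
    have e2 : (max x 0 + 1 - p.2 - 1 + p.1) / p.1 = 1 - q.1 + max x 0 / p.1 := by
      rw [h.snd_eq]; field_simp; ring
    rw [e1, e2]
    rcases le_total x 1 with hx | hx
    · rw [min_eq_left hx]; ring
    · rw [min_eq_right hx]
      have a := h.floor_full hf (y := x) (by linarith)
      have b := h.floor_full hf (y := 1) (by linarith)
      linarith
  have hsecond : towerLift (j + 1) p q f (max (min x 1 - p.2) (1 - p.1)) -
      towerLift (j + 1) p q f (1 - p.1) = f (min t 1 - q.1) := by
    rw [hhigh _ (le_max_right _ _), hhigh _ le_rfl, hf.zero ((1 - p.1 - 1 + p.1) / p.1) (by simp)]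
    have e : (max (min x 1 - p.2) (1 - p.1) - 1 + p.1) / p.1 = max (min t 1 - q.1) 0 := by
      rw [div_eq_iff h0.ne', max_mul_of_nonneg _ _ h0.le, sub_mul, min_mul_of_nonneg _ _ h0.le,
        hxt, h.snd_eq]
      rcases le_total t 1 with h' | h'
      · rw [min_eq_left (by nlinarith), min_eq_left (by nlinarith),
          ← max_sub_sub_right, ← max_add_add_right]
        ring_nf
      · rw [min_eq_right (by nlinarith), min_eq_right (by nlinarith),
          ← max_sub_sub_right, ← max_add_add_right]
        ring_nf
    rw [e]
    rcases le_total (min t 1 - q.1) 0 with h' | h'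
    · rw [max_eq_right h', hf.zero 0 le_rfl, hf.zero _ h']; ring
    · rw [max_eq_left h']; ring
  have hfirst : towerLift (j + 1) p q f (min x 1 - p.1) +
      (f (1 - q.1 + max (min x 1) 0 / p.1) - f (1 - q.1)) =
      ∑ i ∈ Finset.range (j + 2),
        (f (1 - q.1 + max (min x 1 - i * p.1) 0 / p.1) - f (1 - q.1)) := by
    rw [hlow _ (by linarith [min_le_right x 1]), Finset.sum_range_succ' _ (j + 1)]
    simp only [Nat.cast_zero, zero_mul, sub_zero]
    rw [add_left_inj]
    refine Finset.sum_congr rfl fun i _ => ?_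
    rw [show min x 1 - p.1 - i * p.1 = min x 1 - ((i + 1 : ℕ) : ℝ) * p.1 by push_cast; ring]
  have hlast := h.last_floor
  have hL : transfer p (towerLift (j + 1) p q f) x = ∑ i ∈ Finset.range (j + 2),
        (f (1 - q.1 + max (min x 1 - i * p.1) 0 / p.1) - f (1 - q.1)) + f (min t 1 - q.1) := by
    rw [transfer, hsecond, hthird, ← hfirst]
    ring
  rw [hL, ← ht]
  rcases le_total x (1 - p.1) with hx | hx
  · have ht0 : t ≤ 0 := by
      rw [ht]; exact div_nonpos_of_nonpos_of_nonneg (by linarith) h0.le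
    rw [hlow x hx, Finset.sum_range_succ, min_eq_left (by linarith : x ≤ 1),
      floor_empty (by push_cast; nlinarith), transfer, min_eq_left (by linarith : t ≤ 1),
      max_eq_right ht0, max_eq_right (by linarith : t - q.2 ≤ 1 - q.1), hf.zero t ht0]
    rw [zero_add]
    ring
  · have ht0 : 0 ≤ t := by
      rw [ht]; exact div_nonneg (by linarith) h0.le
    have hmin : min x 1 = 1 - p.1 + p.1 * min t 1 := by
      rw [hxt]
      rcases le_total t 1 with h' | h'
      · rw [min_eq_left h', min_eq_left (by nlinarith)]
      · rw [min_eq_right h', min_eq_right (by nlinarith)]; ring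
    have hm0 : 0 ≤ min t 1 := le_min ht0 zero_le_one
    have e1 : max (min x 1 - ((j + 1 : ℕ) : ℝ) * p.1) 0 / p.1 =
        max (min t 1 - q.2) (1 - q.1) - (1 - q.1) := by
      rw [← max_sub_sub_right, div_eq_iff h0.ne', max_mul_of_nonneg _ _ h0.le, hmin]
      push_cast
      congr 1
      · linarith
      · ring
    have e2 : max (min x 1 - j * p.1) 0 / p.1 = q.1 - q.2 + min t 1 := by
      have : min x 1 - j * p.1 = (q.1 - q.2 + min t 1) * p.1 := by rw [hmin]; linarith
      rw [this, max_eq_left (by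
        apply mul_nonneg _ h0.le
        linarith), mul_div_cancel_right₀ _ h0.ne']
    have e3 : f (1 - q.1 + (q.1 - q.2 + min t 1)) = f (max t 0 + 1 - q.2) := by
      rw [max_eq_left ht0]
      rcases le_total t 1 with h' | h'
      · rw [min_eq_left h']; ring_nf
      · rw [min_eq_right h', hf.one _ (by linarith), hf.one (t + 1 - q.2) (by linarith)]
    have hfull : ∀ i ∈ Finset.range j, f (1 - q.1 + max (min x 1 - i * p.1) 0 / p.1) -
        f (1 - q.1) = f 1 - f (1 - q.1) := fun i hi =>
      h.floor_full hf (h.le_sub_mul (Finset.mem_range.1 hi) (le_min hx (by linarith)))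
    rw [hhigh x hx, ← ht, Finset.sum_range_succ, Finset.sum_range_succ,
      Finset.sum_congr rfl hfull, e1, e2, e3, transfer]
    simp only [Finset.sum_const, Finset.card_range, nsmul_eq_mul]
    rw [show 1 - q.1 + (max (min t 1 - q.2) (1 - q.1) - (1 - q.1)) =
      max (min t 1 - q.2) (1 - q.1) by ring]
    ring

/-- The distribution function of the restriction of a measure to `[1 - α, 1)`, rescaled to the
unit interval. -/
def renormDist (p : ℝ × ℝ) (F : ℝ → ℝ) (t : ℝ) : ℝ :=
  F (1 - p.1 + p.1 * max t 0) - F (1 - p.1)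

theorem isDist_renormDist {F : ℝ → ℝ} (hp : p ∈ interior U) (hF : IsDist F) :
    IsDist (renormDist p F) := by
  obtain ⟨p1, p2, p3⟩ := mem_interior_U.1 hp
  have h0 : 0 < p.1 := p1.trans p2
  refine ⟨⟨fun x hx => ?_, fun x hx => ?_⟩, fun x y hxy => ?_⟩
  · simp [renormDist, max_eq_right hx]
  · simp only [renormDist]
    rw [hF.one (1 - p.1 + p.1 * max x 0), hF.one (1 - p.1 + p.1 * max 1 0)]
    · simp
    · nlinarith [le_max_left x 0]
  · apply sub_le_sub_right
    apply hF.mono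
    gcongr

/-- An invariant distribution function is recovered from its restriction to `[1 - α, 1)`. -/
theorem Renorm.towerLift_renormDist (h : Renorm k p q) {F : ℝ → ℝ} (hF : IsDist F)
    (hinv : transfer p F = F) : towerLift k p q (renormDist p F) = F := by
  have h0 := h.fst_pos
  obtain ⟨p1, p2, p3⟩ := mem_interior_U.1 h.mem_left
  obtain ⟨q1, q2, q3⟩ := mem_interior_U.1 h.mem_right
  have hfloor : ∀ y, renormDist p F (1 - q.1 + max y 0 / p.1) - renormDist p F (1 - q.1) =
      F (max y 0 + 1 - p.2) - F (1 - p.2) := by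
    intro y
    have : 0 ≤ max y 0 / p.1 := div_nonneg (le_max_right _ _) h0.le
    simp only [renormDist]
    rw [max_eq_left (by linarith : 0 ≤ 1 - q.1 + max y 0 / p.1),
      max_eq_left (by linarith : 0 ≤ 1 - q.1), h.snd_eq,
      show 1 - p.1 + p.1 * (1 - q.1 + max y 0 / p.1) = max y 0 + 1 - p.1 * q.1 by
        field_simp; ring, show 1 - p.1 + p.1 * (1 - q.1) = 1 - p.1 * q.1 by ring]
    ring
  have hstep : ∀ x, x ≤ 1 - p.1 → F x = F (x - p.1) + (F (max x 0 + 1 - p.2) - F (1 - p.2)) := by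
    intro x hx
    conv_lhs => rw [← hinv]
    rw [transfer, min_eq_left (by linarith : x ≤ 1), max_eq_right (by linarith : x - p.2 ≤ _)]
    ring
  have hsum : ∀ (n : ℕ) x, x ≤ 1 - p.1 → F x = ∑ i ∈ Finset.range n,
      (F (max (x - i * p.1) 0 + 1 - p.2) - F (1 - p.2)) + F (x - n * p.1) := by
    intro n x hx
    induction n with
    | zero => simp
    | succ n ih =>
      rw [Finset.sum_range_succ, ih, hstep (x - n * p.1) (by
        have : 0 ≤ n * p.1 := by positivity
        linarith)]
      push_cast
      rw [show x - n * p.1 - p.1 = x - (n + 1) * p.1 by ring]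
      ring
  have hlow : ∀ x, x ≤ 1 - p.1 → F x = ∑ i ∈ Finset.range k,
      (F (max (x - i * p.1) 0 + 1 - p.2) - F (1 - p.2)) := by
    intro x hx
    have h1 := h.fst_mul
    conv_lhs => rw [hsum k x hx]
    rw [hF.zero (x - k * p.1) (by nlinarith), add_zero]
  ext x
  simp only [towerLift, hfloor]
  rw [← hlow _ (min_le_right _ _)]
  simp only [renormDist]
  rcases le_total x (1 - p.1) with hx | hx
  · rw [min_eq_left hx, max_eq_right (div_nonpos_of_nonpos_of_nonneg (by linarith) h0.le)]
    simp
  · rw [min_eq_right hx, max_eq_left (div_nonneg (by linarith) h0.le), mul_div_cancel₀ _ h0.ne']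
    ring_nf

theorem Renorm.transfer_renormDist (h : Renorm k p q) {F : ℝ → ℝ} (hF : IsDist F)
    (hinv : transfer p F = F) : transfer q (renormDist p F) = renormDist p F := by
  have h0 := h.fst_pos
  ext t
  have := h.transfer_towerLift_sub (isDist_renormDist h.mem_left hF).toIsFlat (1 - p.1 + p.1 * t)
  rw [h.towerLift_renormDist hF hinv, hinv, sub_self,
    show (1 - p.1 + p.1 * t - 1 + p.1) / p.1 = t by field_simp; ring] at this
  linarith

end

/-! ### Mass vectors -/

/-- The inverse of the linear map with matrix `massMat k`. -/
def unstep (k : ℕ) (m : Fin 3 → ℝ) : Fin 3 → ℝ := ![m 1, m 0 - (k - 1) * m 2, k * m 2 - m 0]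

theorem unstep_massMat (k : ℕ) (v : Fin 3 → ℝ) : unstep k (massMat k *ᵥ v) = v := by
  rw [massMat_mulVec]
  ext i
  fin_cases i <;> simp [unstep]
  all_goals ring

theorem massMat_unstep (k : ℕ) (v : Fin 3 → ℝ) : massMat k *ᵥ unstep k v = v := by
  rw [massMat_mulVec]
  ext i
  fin_cases i <;> simp [unstep]
  all_goals ring

/-- The vector of masses at the `n`-th renormalisation level determined by the vector `m` at
level `0`, for the partial quotients `k`. -/
def vecs : (ℕ → ℕ) → (Fin 3 → ℝ) → ℕ → Fin 3 → ℝ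
  | _, m, 0 => m
  | k, m, n + 1 => vecs (fun i => k (i + 1)) (unstep (k 0) m) n

theorem vecs_zero (k : ℕ → ℕ) (m : Fin 3 → ℝ) : vecs k m 0 = m := rfl

theorem vecs_digits_succ (p : ℝ × ℝ) (m : Fin 3 → ℝ) (n : ℕ) :
    vecs (digits p) m (n + 1) = vecs (digits (G p)) (unstep (digit p) m) n := rfl

theorem vecs_succ (k : ℕ → ℕ) (m : Fin 3 → ℝ) (n : ℕ) :
    vecs k m (n + 1) = unstep (k n) (vecs k m n) := by
  induction n generalizing k m with
  | zero => rfl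
  | succ n ih =>
    rw [vecs, ih]
    rfl

theorem vecs_eq_mulVec (k : ℕ → ℕ) (m : Fin 3 → ℝ) (n : ℕ) :
    vecs k m n = massMat (k n) *ᵥ vecs k m (n + 1) := by
  rw [vecs_succ, massMat_unstep]

/-- The normalised vectors `m` for which all `vecs k m n` are nonnegative; these turn out to be the
mass vectors of the invariant probability measures. -/
def massVectors (k : ℕ → ℕ) : Set (Fin 3 → ℝ) :=
  {m | (∀ n, 0 ≤ vecs k m n) ∧ ∑ i, m i = 1}

theorem sum_vecs_sub (k : ℕ → ℕ) (m : Fin 3 → ℝ) (n : ℕ) :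
    ∑ i, vecs k m n i - ∑ i, vecs k m (n + 1) i = vecs k m n 0 := by
  rw [vecs_succ]
  simp only [Fin.sum_univ_three, unstep]
  simp
  ring

theorem tendsto_sum_vecs {k : ℕ → ℕ} (hk : ∀ N, ∃ n, N ≤ n ∧ 2 ≤ k n) {m : Fin 3 → ℝ}
    (hm : ∀ n, 0 ≤ vecs k m n) : Tendsto (fun n => ∑ i, vecs k m n i) atTop (𝓝 0) := by
  have hs0 : ∀ n, 0 ≤ ∑ i, vecs k m n i := fun n => Finset.sum_nonneg fun i _ => hm n i
  have hanti : Antitone fun n => ∑ i, vecs k m n i := by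
    refine antitone_nat_of_succ_le fun n => ?_
    have h1 := sum_vecs_sub k m n
    have h2 : 0 ≤ vecs k m n 0 := hm n 0
    linarith
  have hlim := tendsto_atTop_ciInf hanti ⟨0, by rintro _ ⟨n, rfl⟩; exact hs0 n⟩
  -- the total masses of consecutive levels differ by the first coordinate, which is summable
  have h0 : Tendsto (fun n => vecs k m n 0) atTop (𝓝 0) := by
    have := hlim.sub (hlim.comp (tendsto_add_atTop_nat 1))
    rw [sub_self] at this
    exact this.congr fun n => sum_vecs_sub k m n
  rw [Metric.tendsto_atTop]
  intro ε hε
  obtain ⟨N, hN⟩ := (Metric.tendsto_atTop.1 h0) (ε / 3) (by positivity)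
  have hN' : ∀ n ≥ N, vecs k m n 0 < ε / 3 := by
    intro n hn
    have := hN n hn
    rw [Real.dist_eq, sub_zero] at this
    exact (le_abs_self _).trans_lt this
  obtain ⟨a, ha, hka⟩ := hk N
  refine ⟨a + 1, fun n hn => ?_⟩
  rw [Real.dist_eq, sub_zero, abs_of_nonneg (hs0 n)]
  refine (hanti hn).trans_lt ?_
  have e1 : vecs k m (a + 1) 1 = vecs k m (a + 2) 0 := by
    rw [vecs_succ k m (a + 1)]
    simp [unstep]
  have e2 : vecs k m (a + 1) 2 ≤ vecs k m a 0 := by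
    have h1 : vecs k m a 0 = k a * vecs k m (a + 1) 1 + (k a - 1) * vecs k m (a + 1) 2 := by
      rw [vecs_eq_mulVec k m a, massMat_mulVec]
      simp
    have h2 : (2 : ℝ) ≤ k a := by exact_mod_cast hka
    have h3 : 0 ≤ vecs k m (a + 1) 1 := hm _ 1
    have h4 : 0 ≤ vecs k m (a + 1) 2 := hm _ 2
    nlinarith
  simp only [Fin.sum_univ_three]
  have := hN' a ha
  have := hN' (a + 1) (by omega)
  have := hN' (a + 2) (by omega)
  linarith

theorem frequently_two_le_digits {p : ℝ × ℝ} (hp : p ∈ A) (N : ℕ) :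
    ∃ n, N ≤ n ∧ 2 ≤ digits p n := by
  obtain ⟨j, hj⟩ := exists_two_le_digits hp N
  exact ⟨_, by omega, hj⟩

theorem vecs_mass_nonneg {p : ℝ × ℝ} (hp : p ∈ A) {F : ℝ → ℝ} (hF : IsDist F)
    (hinv : transfer p F = F) (n : ℕ) : 0 ≤ vecs (digits p) (mass p F) n := by
  induction n generalizing p F with
  | zero => exact hF.mass_nonneg (A_subset hp)
  | succ n ih =>
    have hr := renorm_of_mem_A hp
    have hf := isDist_renormDist (A_subset hp) hF
    rw [vecs_digits_succ, ← hr.towerLift_renormDist hF hinv, hr.mass_towerLift hf.toIsFlat,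
      unstep_massMat]
    exact ih (G_mem_A hp) hf (hr.transfer_renormDist hF hinv)

/-- Two invariant distribution functions with the same masses differ by no more than the total mass
at level `n`, which bounds their difference there. -/
theorem abs_sub_le_sum_vecs {p : ℝ × ℝ} (hp : p ∈ A) {F H : ℝ → ℝ} (hF : IsDist F) (hH : IsDist H)
    (hFinv : transfer p F = F) (hHinv : transfer p H = H) (hmass : mass p F = mass p H) (n : ℕ)
    (x : ℝ) : |F x - H x| ≤ ∑ i, vecs (digits p) (mass p F) n i := by
  induction n generalizing p F H x with
  | zero =>
    have h1 : F 1 = H 1 := by rw [← sum_mass p F, ← sum_mass p H, hmass]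
    rw [vecs_zero, sum_mass, abs_le]
    have := hF.nonneg x
    have := hF.le_one x
    have := hH.nonneg x
    have := hH.le_one x
    constructor <;> linarith
  | succ n ih =>
    have hr := renorm_of_mem_A hp
    have hf := isDist_renormDist (A_subset hp) hF
    have hh := isDist_renormDist (A_subset hp) hH
    have eF := hr.towerLift_renormDist hF hFinv
    have eH := hr.towerLift_renormDist hH hHinv
    have hm1 : mass (G p) (renormDist p F) = unstep (digit p) (mass p F) := by
      conv_rhs => rw [← eF, hr.mass_towerLift hf.toIsFlat, unstep_massMat]
    have hm2 : mass (G p) (renormDist p H) = unstep (digit p) (mass p H) := by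
      conv_rhs => rw [← eH, hr.mass_towerLift hh.toIsFlat, unstep_massMat]
    have hmm : mass (G p) (renormDist p F) = mass (G p) (renormDist p H) := by
      rw [hm1, hm2, hmass]
    have hle := ih (G_mem_A hp) hf hh (hr.transfer_renormDist hF hFinv)
      (hr.transfer_renormDist hH hHinv) hmm
    have := hr.abs_towerLift_le (hf.toIsFlat.sub hh.toIsFlat)
      (by rw [mass_sub, hmm, sub_self]) hle x
    rw [towerLift_sub, eF, eH, hm1] at this
    exact this

/-- Invariant distribution functions of an infinite type parameter are determined by the masses
of the three continuity intervals. -/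
theorem eq_of_mass_eq {p : ℝ × ℝ} (hp : p ∈ A) {F H : ℝ → ℝ} (hF : IsDist F) (hH : IsDist H)
    (hFinv : transfer p F = F) (hHinv : transfer p H = H) (hmass : mass p F = mass p H) :
    F = H := by
  ext x
  have hlim := tendsto_sum_vecs (frequently_two_le_digits hp) (vecs_mass_nonneg hp hF hFinv)
  have := ge_of_tendsto' hlim fun n => abs_sub_le_sum_vecs hp hF hH hFinv hHinv hmass n x
  have := abs_nonpos_iff.1 this
  linarith

/-! ### Construction of invariant distribution functions -/

/-- The piecewise linear distribution function with prescribed masses of the three continuity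
intervals. -/
def interp (p : ℝ × ℝ) (m : Fin 3 → ℝ) (x : ℝ) : ℝ :=
  m 0 * max 0 (min (x / (1 - p.1)) 1) + m 1 * max 0 (min ((x - (1 - p.1)) / (p.1 - p.2)) 1) +
    m 2 * max 0 (min ((x - (1 - p.2)) / p.2) 1)

theorem clamp_of_nonpos {a : ℝ} (ha : a ≤ 0) : max 0 (min a 1) = 0 :=
  max_eq_left (min_le_of_left_le ha)

theorem clamp_of_one_le {a : ℝ} (ha : 1 ≤ a) : max 0 (min a 1) = 1 := by
  rw [min_eq_right ha, max_eq_right zero_le_one]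

theorem isDist_interp {p : ℝ × ℝ} (hp : p ∈ interior U) {m : Fin 3 → ℝ} (hm : 0 ≤ m) :
    IsDist (interp p m) := by
  obtain ⟨h1, h2, h3⟩ := mem_interior_U.1 hp
  have m0 := hm 0
  have m1 := hm 1
  have m2 := hm 2
  simp only [Pi.zero_apply] at m0 m1 m2
  have a1 : 0 < 1 - p.1 := by linarith
  have a2 : 0 < p.1 - p.2 := by linarith
  refine ⟨⟨fun x hx => ?_, fun x hx => ?_⟩, fun x y hxy => ?_⟩
  · simp only [interp]
    rw [clamp_of_nonpos (div_nonpos_of_nonpos_of_nonneg hx a1.le),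
      clamp_of_nonpos (div_nonpos_of_nonpos_of_nonneg (by linarith) a2.le),
      clamp_of_nonpos (div_nonpos_of_nonpos_of_nonneg (by linarith) h1.le)]
    ring
  · have key : ∀ x, 1 ≤ x → interp p m x = m 0 + m 1 + m 2 := by
      intro x hx
      simp only [interp]
      rw [clamp_of_one_le ((one_le_div a1).2 (by linarith)),
        clamp_of_one_le ((one_le_div a2).2 (by linarith)),
        clamp_of_one_le ((one_le_div h1).2 (by linarith))]
      ring
    rw [key x hx, key 1 le_rfl]
  · simp only [interp]
    gcongr

theorem continuous_interp (p : ℝ × ℝ) (m : Fin 3 → ℝ) : Continuous (interp p m) := by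
  unfold interp
  fun_prop

theorem mass_interp {p : ℝ × ℝ} (hp : p ∈ interior U) (m : Fin 3 → ℝ) :
    mass p (interp p m) = m := by
  obtain ⟨h1, h2, h3⟩ := mem_interior_U.1 hp
  have a1 : 0 < 1 - p.1 := by linarith
  have a2 : 0 < p.1 - p.2 := by linarith
  have e1 : interp p m (1 - p.1) = m 0 := by
    simp only [interp]
    rw [clamp_of_one_le ((one_le_div a1).2 (by linarith)),
      clamp_of_nonpos (div_nonpos_of_nonpos_of_nonneg (by linarith) a2.le),
      clamp_of_nonpos (div_nonpos_of_nonpos_of_nonneg (by linarith) h1.le)]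
    ring
  have e2 : interp p m (1 - p.2) = m 0 + m 1 := by
    simp only [interp]
    rw [clamp_of_one_le ((one_le_div a1).2 (by linarith)),
      clamp_of_one_le ((one_le_div a2).2 (by linarith)),
      clamp_of_nonpos (div_nonpos_of_nonpos_of_nonneg (by linarith) h1.le)]
    ring
  have e3 : interp p m 1 = m 0 + m 1 + m 2 := by
    simp only [interp]
    rw [clamp_of_one_le ((one_le_div a1).2 (by linarith)),
      clamp_of_one_le ((one_le_div a2).2 (by linarith)),
      clamp_of_one_le ((one_le_div h1).2 (by linarith))]
    ring
  ext i
  fin_cases i <;> simp [mass, e1, e2, e3]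

/-- The lift to level `0` of the piecewise linear distribution function at level `n` whose lift
has masses `m`. -/
def approx : ℕ → ℝ × ℝ → (Fin 3 → ℝ) → ℝ → ℝ
  | 0, p, m => interp p m
  | n + 1, p, m => towerLift (digit p) p (G p) (approx n (G p) (unstep (digit p) m))

section

variable {p : ℝ × ℝ} {m : Fin 3 → ℝ}

theorem isDist_approx (hp : p ∈ A) (hm : ∀ n, 0 ≤ vecs (digits p) m n) (n : ℕ) :
    IsDist (approx n p m) := by
  induction n generalizing p m with
  | zero => exact isDist_interp (A_subset hp) (hm 0)
  | succ n ih =>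
    exact (renorm_of_mem_A hp).isDist_towerLift (ih (G_mem_A hp) fun n => hm (n + 1))

theorem continuous_approx (p : ℝ × ℝ) (m : Fin 3 → ℝ) (n : ℕ) : Continuous (approx n p m) := by
  induction n generalizing p m with
  | zero => exact continuous_interp p m
  | succ n ih => exact continuous_towerLift (ih _ _)

theorem mass_approx (hp : p ∈ A) (hm : ∀ n, 0 ≤ vecs (digits p) m n) (n : ℕ) :
    mass p (approx n p m) = m := by
  induction n generalizing p m with
  | zero => exact mass_interp (A_subset hp) m
  | succ n ih =>
    have hm' : ∀ n, 0 ≤ vecs (digits (G p)) (unstep (digit p) m) n := fun n => hm (n + 1)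
    rw [approx, (renorm_of_mem_A hp).mass_towerLift (isDist_approx (G_mem_A hp) hm' n).toIsFlat,
      ih (G_mem_A hp) hm', massMat_unstep]

theorem approx_one (hp : p ∈ A) (hm : ∀ n, 0 ≤ vecs (digits p) m n) (n : ℕ) :
    approx n p m 1 = ∑ i, m i := by
  rw [← sum_mass p (approx n p m), mass_approx hp hm]

theorem abs_approx_sub_le (hp : p ∈ A) (hm : ∀ n, 0 ≤ vecs (digits p) m n) (n j : ℕ) (x : ℝ) :
    |approx n p m x - approx (n + j) p m x| ≤ ∑ i, vecs (digits p) m n i := by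
  induction n generalizing p m x with
  | zero =>
    have h1 := isDist_approx hp hm 0
    have h2 := isDist_approx hp hm (0 + j)
    have e1 := approx_one hp hm 0
    have e2 := approx_one hp hm (0 + j)
    rw [vecs_zero, abs_le]
    have := h1.nonneg x
    have := h1.le_one x
    have := h2.nonneg x
    have := h2.le_one x
    constructor <;> linarith
  | succ n ih =>
    have hm' : ∀ n, 0 ≤ vecs (digits (G p)) (unstep (digit p) m) n := fun n => hm (n + 1)
    have h1 := isDist_approx (G_mem_A hp) hm' n
    have h2 := isDist_approx (G_mem_A hp) hm' (n + j)
    have := (renorm_of_mem_A hp).abs_towerLift_le (h1.toIsFlat.sub h2.toIsFlat)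
      (by rw [mass_sub, mass_approx (G_mem_A hp) hm', mass_approx (G_mem_A hp) hm', sub_self])
      (ih (G_mem_A hp) hm') x
    rw [towerLift_sub] at this
    rw [show n + 1 + j = n + j + 1 by ring]
    exact this

/-- The approximations are invariant up to an error that is small with the total mass at level `n`;
the constant `6` counts the values of the function that enter the defect. -/
theorem abs_transfer_approx_sub_le (hp : p ∈ A) (hm : ∀ n, 0 ≤ vecs (digits p) m n) (n : ℕ)
    (x : ℝ) : |transfer p (approx n p m) x - approx n p m x| ≤
      6 * ∑ i, vecs (digits p) m n i := by
  induction n generalizing p m x with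
  | zero =>
    have h1 := isDist_approx hp hm 0
    have e1 := approx_one hp hm 0
    have a : ∀ y, 0 ≤ approx 0 p m y ∧ approx 0 p m y ≤ ∑ i, m i := fun y =>
      ⟨h1.nonneg y, e1 ▸ h1.le_one y⟩
    rw [vecs_zero, abs_le, transfer]
    have := a x
    have := a (min x 1 - p.1)
    have := a (max (min x 1 - p.2) (1 - p.1))
    have := a (1 - p.1)
    have := a (max x 0 + 1 - p.2)
    have := a (1 - p.2)
    constructor <;> linarith
  | succ n ih =>
    have hm' : ∀ n, 0 ≤ vecs (digits (G p)) (unstep (digit p) m) n := fun n => hm (n + 1)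
    have h1 := isDist_approx (G_mem_A hp) hm' n
    rw [approx, (renorm_of_mem_A hp).transfer_towerLift_sub h1.toIsFlat]
    exact ih (G_mem_A hp) hm' _

/-- Every admissible mass vector is realised by a continuous invariant distribution function. -/
theorem exists_invariant_dist (hp : p ∈ A) (hm : ∀ n, 0 ≤ vecs (digits p) m n) :
    ∃ F, IsDist F ∧ Continuous F ∧ transfer p F = F ∧ mass p F = m := by
  have hs := tendsto_sum_vecs (frequently_two_le_digits hp) hm
  have hcau : ∀ x, ∃ y, Tendsto (fun n => approx n p m x) atTop (𝓝 y) := by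
    intro x
    apply cauchySeq_tendsto_of_complete
    refine cauchySeq_of_le_tendsto_0' (fun n => ∑ i, vecs (digits p) m n i)
      (fun n l hnl => ?_) hs
    obtain ⟨j, rfl⟩ := Nat.exists_eq_add_of_le hnl
    exact abs_approx_sub_le hp hm n j x
  choose F hF using hcau
  have hle : ∀ n x, |approx n p m x - F x| ≤ ∑ i, vecs (digits p) m n i := by
    intro n x
    have h1 : Tendsto (fun j => |approx n p m x - approx (n + j) p m x|) atTop
        (𝓝 |approx n p m x - F x|) := by
      have := (hF x).comp (tendsto_add_atTop_nat n)
      refine ((tendsto_const_nhds.sub this).abs).congr fun j => ?_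
      simp [add_comm]
    exact le_of_tendsto' h1 fun j => abs_approx_sub_le hp hm n j x
  have hunif : TendstoUniformly (fun n => approx n p m) F atTop := by
    rw [Metric.tendstoUniformly_iff]
    intro ε hε
    filter_upwards [hs.eventually (gt_mem_nhds hε)] with n hn x
    rw [dist_comm, Real.dist_eq]
    exact (hle n x).trans_lt hn
  have hdist := isDist_approx hp hm
  have hmassF : mass p F = m := by
    have e : ∀ n, approx n p m (1 - p.1) = m 0 ∧
        approx n p m (1 - p.2) - approx n p m (1 - p.1) = m 1 ∧
        approx n p m 1 - approx n p m (1 - p.2) = m 2 := by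
      intro n
      have := mass_approx hp hm n
      refine ⟨by simpa [mass] using congrFun this 0, by simpa [mass] using congrFun this 1,
        by simpa [mass] using congrFun this 2⟩
    ext i
    fin_cases i <;> simp [mass]
    · exact tendsto_nhds_unique (hF _) (tendsto_const_nhds.congr fun n => (e n).1.symm)
    · exact tendsto_nhds_unique ((hF _).sub (hF _))
        (tendsto_const_nhds.congr fun n => (e n).2.1.symm)
    · exact tendsto_nhds_unique ((hF _).sub (hF _))
        (tendsto_const_nhds.congr fun n => (e n).2.2.symm)
  refine ⟨F, ⟨⟨fun x hx => ?_, fun x hx => ?_⟩, fun x y hxy => ?_⟩, ?_, ?_, hmassF⟩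
  · exact tendsto_nhds_unique (hF x)
      (tendsto_const_nhds.congr fun n => ((hdist n).zero x hx).symm)
  · exact tendsto_nhds_unique (hF x) ((hF 1).congr fun n => ((hdist n).one x hx).symm)
  · exact le_of_tendsto_of_tendsto' (hF x) (hF y) fun n => (hdist n).mono hxy
  · exact hunif.continuous (Frequently.of_forall fun n => continuous_approx p m n)
  · ext x
    have h1 : Tendsto (fun n => transfer p (approx n p m) x - approx n p m x) atTop
        (𝓝 (transfer p F x - F x)) := by
      unfold transfer
      exact (((hF _).add ((hF _).sub (hF _))).add ((hF _).sub (hF _))).sub (hF x)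
    have h2 : Tendsto (fun n => transfer p (approx n p m) x - approx n p m x) atTop (𝓝 0) := by
      refine squeeze_zero_norm (fun n => abs_transfer_approx_sub_le hp hm n x) ?_
      simpa using hs.const_mul 6
    exact sub_eq_zero.1 (tendsto_nhds_unique h1 h2)

end

/-! ### Invariant measures and their distribution functions -/

/-- The distribution function `x ↦ μ [0, x)` of a measure on `[0, 1)`. -/
def distFun (μ : Measure (Ico (0 : ℝ) 1)) (x : ℝ) : ℝ := μ.real {t | (t : ℝ) < x}

theorem measurableSet_coe_lt (x : ℝ) : MeasurableSet {t : Ico (0 : ℝ) 1 | (t : ℝ) < x} :=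
  measurable_subtype_coe measurableSet_Iio

theorem isDist_distFun (μ : Measure (Ico (0 : ℝ) 1)) [IsFiniteMeasure μ] :
    IsDist (distFun μ) := by
  refine ⟨⟨fun x hx => ?_, fun x hx => ?_⟩, fun x y hxy => ?_⟩
  · have : {t : Ico (0 : ℝ) 1 | (t : ℝ) < x} = ∅ := by
      ext t
      simpa using hx.trans t.2.1
    simp [distFun, this]
  · unfold distFun
    congr 1
    ext t
    simpa [t.2.2] using t.2.2.trans_le hx
  · exact measureReal_mono fun t ht => lt_of_lt_of_le ht hxy

theorem distFun_one (μ : Measure (Ico (0 : ℝ) 1)) : distFun μ 1 = μ.real univ := by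
  unfold distFun
  congr 1
  ext t
  simpa using t.2.2

theorem measureReal_le_and_lt (μ : Measure (Ico (0 : ℝ) 1)) [IsFiniteMeasure μ] {a b : ℝ}
    (hab : a ≤ b) : μ.real {t | a ≤ (t : ℝ) ∧ (t : ℝ) < b} = distFun μ b - distFun μ a := by
  have hsub : {t : Ico (0 : ℝ) 1 | (t : ℝ) < a} ⊆ {t | (t : ℝ) < b} :=
    fun t ht => lt_of_lt_of_le ht hab
  rw [distFun, distFun, ← measureReal_sdiff hsub (measurableSet_coe_lt a)]
  congr 1
  ext t
  simp [and_comm]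

theorem ext_of_distFun {μ ν : Measure (Ico (0 : ℝ) 1)} [IsFiniteMeasure μ] [IsFiniteMeasure ν]
    (h : distFun μ = distFun ν) : μ = ν := by
  have hemb : MeasurableEmbedding ((↑) : Ico (0 : ℝ) 1 → ℝ) :=
    MeasurableEmbedding.subtype_coe measurableSet_Ico
  have hmap : μ.map (↑) = ν.map ((↑) : Ico (0 : ℝ) 1 → ℝ) := by
    refine ext_of_generate_finite (range Iio) ?_ isPiSystem_Iio ?_ ?_
    · rw [← borel_eq_generateFrom_Iio]
      exact BorelSpace.measurable_eq
    · rintro _ ⟨x, rfl⟩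
      rw [hemb.map_apply, hemb.map_apply]
      exact (measureReal_eq_measureReal_iff).1 (congrFun h x)
    · rw [hemb.map_apply, hemb.map_apply, preimage_univ]
      have := congrFun h 1
      rw [distFun_one, distFun_one] at this
      exact (measureReal_eq_measureReal_iff).1 this
  rw [← hemb.comap_map μ, hmap, hemb.comap_map]

theorem measurable_T (p : interior U) : Measurable (T p) := by
  unfold T formula
  apply Measurable.subtype_mk
  refine Measurable.ite (measurableSet_coe_lt _) (by fun_prop) ?_
  exact Measurable.ite (measurableSet_coe_lt _) (by fun_prop) (by fun_prop)

/-- `transfer` describes the push-forward of measures under `T`. -/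
theorem distFun_map_T (p : interior U) (μ : Measure (Ico (0 : ℝ) 1)) [IsFiniteMeasure μ] :
    distFun (μ.map (T p)) = transfer p.1 (distFun μ) := by
  obtain ⟨h1, h2, h3⟩ := mem_interior_U.1 p.2
  obtain ⟨⟨α, β⟩, hp⟩ := p
  simp only at h1 h2 h3
  ext x
  have hset : T ⟨(α, β), hp⟩ ⁻¹' {t : Ico (0 : ℝ) 1 | (t : ℝ) < x} =
      ({t : Ico (0 : ℝ) 1 | (t : ℝ) < min x 1 - α} ∪
        {t | 1 - α ≤ (t : ℝ) ∧ (t : ℝ) < max (min x 1 - β) (1 - α)}) ∪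
        {t | 1 - β ≤ (t : ℝ) ∧ (t : ℝ) < max x 0 + 1 - β} := by
    ext ⟨t, ht0, ht1⟩
    simp only [T, formula, mem_preimage, mem_ofPred_eq, mem_union, lt_max_iff]
    have e1 : t < min x 1 - α ↔ t + α < x ∧ t + α < 1 := by
      rw [lt_sub_iff_add_lt, lt_min_iff]
    have e2 : t < min x 1 - β ↔ t + β < x ∧ t + β < 1 := by
      rw [lt_sub_iff_add_lt, lt_min_iff]
    rw [e1, e2]
    rcases lt_or_ge t (1 - α) with ha | ha
    · simp only [if_pos ha]
      constructor
      · intro h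
        exact Or.inl (Or.inl ⟨h, by linarith⟩)
      · rintro ((h | h) | h)
        · exact h.1
        · linarith [h.1]
        · linarith [h.1]
    · simp only [if_neg ha.not_gt]
      rcases lt_or_ge t (1 - β) with hb | hb
      · simp only [if_pos hb]
        constructor
        · intro h
          exact Or.inl (Or.inr ⟨ha, Or.inl ⟨h, by linarith⟩⟩)
        · rintro ((h | ⟨_, h | h⟩) | h)
          · linarith [h.2]
          · exact h.1
          · linarith
          · linarith [h.1]
      · simp only [if_neg hb.not_gt]
        constructor
        · intro h
          exact Or.inr ⟨hb, by linarith [le_max_left x 0]⟩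
        · rintro ((h | ⟨_, h | h⟩) | h)
          · linarith [h.2]
          · linarith [h.2]
          · linarith
          · rcases le_total x 0 with hx | hx
            · rw [max_eq_right hx] at h; linarith [h.2]
            · rw [max_eq_left hx] at h; linarith [h.2]
  have hmeas : ∀ a b : ℝ, MeasurableSet {t : Ico (0 : ℝ) 1 | a ≤ (t : ℝ) ∧ (t : ℝ) < b} :=
    fun a b => measurable_subtype_coe measurableSet_Ico
  have hmap : distFun (μ.map (T ⟨(α, β), hp⟩)) x =
      μ.real (T ⟨(α, β), hp⟩ ⁻¹' {t | (t : ℝ) < x}) :=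
    map_measureReal_apply (measurable_T _) (measurableSet_coe_lt x)
  have hmin := min_le_right x 1
  rw [hmap, hset, measureReal_union _ (hmeas _ _), measureReal_union _ (hmeas _ _),
    measureReal_le_and_lt μ (le_max_right _ _),
    measureReal_le_and_lt μ (by linarith [le_max_right x 0])]
  · rfl
  · rw [Set.disjoint_left]
    rintro t ht ⟨ht1, _⟩
    simp only [mem_ofPred_eq] at ht
    linarith
  · rw [Set.disjoint_left]
    rintro t (ht | ⟨_, ht⟩) ⟨ht1, _⟩
    · simp only [mem_ofPred_eq] at ht
      linarith
    · rcases lt_max_iff.1 ht with h | h <;> linarith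

theorem exists_distFun_eq {F : ℝ → ℝ} (hF : IsDist F) (hc : Continuous F) (h1 : F 1 = 1) :
    ∃ μ : Measure (Ico (0 : ℝ) 1), IsProbabilityMeasure μ ∧ distFun μ = F := by
  have hemb : MeasurableEmbedding ((↑) : Ico (0 : ℝ) 1 → ℝ) :=
    MeasurableEmbedding.subtype_coe measurableSet_Ico
  let S : StieltjesFunction ℝ := ⟨F, hF.mono, fun x => hc.continuousWithinAt⟩
  have hleft : ∀ x, Function.leftLim S x = F x := fun x =>
    hc.continuousAt.continuousWithinAt.leftLim_eq
  let μ : Measure (Ico (0 : ℝ) 1) := S.measure.comap (↑)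
  have hμ : ∀ x, 0 ≤ x → μ {t | (t : ℝ) < x} = ENNReal.ofReal (F x) := by
    intro x hx
    rw [hemb.comap_apply]
    have : ((↑) : Ico (0 : ℝ) 1 → ℝ) '' {t | (t : ℝ) < x} = Ico 0 (min 1 x) := by
      ext t
      simp only [mem_image, mem_ofPred_eq, Subtype.exists, mem_Ico, lt_min_iff]
      constructor
      · rintro ⟨a, ha, hax, rfl⟩
        exact ⟨ha.1, ha.2, hax⟩
      · rintro ⟨a, b, c⟩
        exact ⟨t, ⟨a, b⟩, c, rfl⟩
    rw [this, S.measure_Ico, hleft, hleft, hF.zero 0 le_rfl, sub_zero]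
    rcases le_total 1 x with h | h
    · rw [min_eq_left h, hF.one x h]
    · rw [min_eq_right h]
  have hprob : IsProbabilityMeasure μ := by
    refine ⟨?_⟩
    have : (univ : Set (Ico (0 : ℝ) 1)) = {t : Ico (0 : ℝ) 1 | (t : ℝ) < 1} := by
      ext t
      simpa using t.2.2
    rw [this, hμ 1 zero_le_one, h1, ENNReal.ofReal_one]
  refine ⟨μ, hprob, ?_⟩
  ext x
  rcases le_total x 0 with hx | hx
  · rw [(isDist_distFun μ).zero x hx, hF.zero x hx]
  · rw [distFun, Measure.real, hμ x hx, ENNReal.toReal_ofReal (hF.nonneg x)]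

/-- For infinite type parameters, taking the masses of the continuity intervals is a bijection
between invariant probability measures and admissible mass vectors. -/
theorem uniquelyErgodic_iff {p : ℝ × ℝ} (hp : p ∈ A) :
    UniquelyErgodic (T ⟨p, A_subset hp⟩) ↔ ∃! m, m ∈ massVectors (digits p) := by
  have hfix : ∀ μ : Measure (Ico (0 : ℝ) 1), MeasurePreserving (T ⟨p, A_subset hp⟩) μ μ →
      IsProbabilityMeasure μ → transfer p (distFun μ) = distFun μ := by
    intro μ hμ _
    rw [← distFun_map_T ⟨p, A_subset hp⟩ μ, hμ.map_eq]
  have hmem : ∀ μ : Measure (Ico (0 : ℝ) 1), MeasurePreserving (T ⟨p, A_subset hp⟩) μ μ →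
      IsProbabilityMeasure μ → mass p (distFun μ) ∈ massVectors (digits p) := by
    intro μ hμ _
    refine ⟨vecs_mass_nonneg hp (isDist_distFun μ) (hfix μ hμ ‹_›), ?_⟩
    rw [sum_mass, distFun_one, probReal_univ]
  have hsurj : ∀ m ∈ massVectors (digits p), ∃ μ : Measure (Ico (0 : ℝ) 1),
      IsProbabilityMeasure μ ∧ MeasurePreserving (T ⟨p, A_subset hp⟩) μ μ ∧
        mass p (distFun μ) = m := by
    intro m hm
    obtain ⟨F, hF, hc, hinv, hmass⟩ := exists_invariant_dist hp hm.1
    obtain ⟨μ, hμ, rfl⟩ := exists_distFun_eq hF hc (by rw [← sum_mass p F, hmass, hm.2])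
    refine ⟨μ, hμ, ⟨measurable_T _, ?_⟩, hmass⟩
    have := Measure.isFiniteMeasure_map μ (T ⟨p, A_subset hp⟩)
    apply ext_of_distFun
    rw [distFun_map_T, hinv]
  constructor
  · rintro ⟨μ, ⟨hμ, hT⟩, huniq⟩
    refine ⟨_, hmem μ hT hμ, fun m hm => ?_⟩
    obtain ⟨ν, hν, hνT, rfl⟩ := hsurj m hm
    rw [huniq ν ⟨hν, hνT⟩]
  · rintro ⟨m, hm, huniq⟩
    obtain ⟨μ, hμ, hT, hmass⟩ := hsurj m hm
    refine ⟨μ, ⟨hμ, hT⟩, fun ν ⟨hν, hνT⟩ => ?_⟩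
    apply ext_of_distFun
    refine eq_of_mass_eq hp (isDist_distFun ν) (isDist_distFun μ) (hfix ν hνT hν) (hfix μ hT hμ) ?_
    rw [hmass]
    exact huniq _ (hmem ν hνT hν)

/-! ### Unique ergodicity as a countable intersection of open conditions -/

/-- The normalised vectors `m` for which `vecs k m i` is nonnegative for `i ≤ n`: the
approximations from outside of `massVectors k`, determined by the first `n` partial quotients. -/
def massVectorsUpTo (k : ℕ → ℕ) (n : ℕ) : Set (Fin 3 → ℝ) :=
  {m | (∀ i ≤ n, 0 ≤ vecs k m i) ∧ ∑ i, m i = 1}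

theorem vecs_congr {k k' : ℕ → ℕ} {n : ℕ} (h : ∀ i < n, k i = k' i) (m : Fin 3 → ℝ) :
    vecs k m n = vecs k' m n := by
  induction n with
  | zero => rfl
  | succ n ih => rw [vecs_succ, vecs_succ, ih fun i hi => h i (by omega), h n (by omega)]

theorem massVectorsUpTo_congr {k k' : ℕ → ℕ} {n : ℕ} (h : ∀ i < n, k i = k' i) :
    massVectorsUpTo k n = massVectorsUpTo k' n := by
  ext m
  have : ∀ i ≤ n, vecs k m i = vecs k' m i := fun i hi =>
    vecs_congr (fun j hj => h j (hj.trans_le hi)) m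
  simp only [massVectorsUpTo, mem_ofPred_eq]
  rw [forall₂_congr fun i hi => by rw [this i hi]]

theorem massVectorsUpTo_anti (k : ℕ → ℕ) {n n' : ℕ} (h : n ≤ n') :
    massVectorsUpTo k n' ⊆ massVectorsUpTo k n :=
  fun _ hm => ⟨fun i hi => hm.1 i (hi.trans h), hm.2⟩

theorem continuous_vecs (k : ℕ → ℕ) (n : ℕ) : Continuous fun m => vecs k m n := by
  induction n with
  | zero => exact continuous_id
  | succ n ih =>
    simp only [vecs_succ]
    have : Continuous (unstep (k n)) := by
      unfold unstep
      fun_prop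
    exact this.comp ih

theorem vecs_smul (k : ℕ → ℕ) (c : ℝ) (m : Fin 3 → ℝ) (n : ℕ) :
    vecs k (c • m) n = c • vecs k m n := by
  induction n with
  | zero => rfl
  | succ n ih =>
    rw [vecs_succ, vecs_succ, ih]
    ext i
    fin_cases i <;> simp [unstep]
    all_goals ring

theorem isCompact_massVectorsUpTo (k : ℕ → ℕ) (n : ℕ) : IsCompact (massVectorsUpTo k n) := by
  have hsub : massVectorsUpTo k n ⊆ stdSimplex ℝ (Fin 3) := fun m hm =>
    ⟨fun i => hm.1 0 (Nat.zero_le n) i, hm.2⟩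
  refine (isCompact_stdSimplex ℝ (Fin 3)).of_isClosed_subset ?_ hsub
  have heq : massVectorsUpTo k n =
      (⋂ i, ⋂ _ : i ≤ n, {m | 0 ≤ vecs k m i}) ∩ {m | ∑ i, m i = 1} := by
    ext m
    simp [massVectorsUpTo]
  rw [heq]
  refine IsClosed.inter ?_ ?_
  · exact isClosed_iInter fun i => isClosed_iInter fun _ =>
      isClosed_le continuous_const (continuous_vecs k i)
  · exact isClosed_eq (by fun_prop) continuous_const

theorem massVectorsUpTo_nonempty {k : ℕ → ℕ} (hk : ∀ n, 1 ≤ k n) (n : ℕ) :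
    (massVectorsUpTo k n).Nonempty := by
  obtain ⟨m, hm, hpos⟩ : ∃ m, (∀ i ≤ n, 0 ≤ vecs k m i) ∧ 0 < ∑ i, m i := by
    induction n generalizing k with
    | zero =>
      refine ⟨fun _ => 1, fun i hi => ?_, by simp⟩
      rw [Nat.le_zero.1 hi]
      exact fun _ => zero_le_one
    | succ n ih =>
      obtain ⟨m, hm, hpos⟩ := ih fun i => hk (i + 1)
      have hm0 : 0 ≤ m := hm 0 (Nat.zero_le n)
      have hM : 0 ≤ massMat (k 0) *ᵥ m := mulVec_nonneg_of_nonneg (massMat_nonneg (hk 0)) hm0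
      refine ⟨massMat (k 0) *ᵥ m, fun i hi => ?_, ?_⟩
      · cases i with
        | zero => exact hM
        | succ i =>
          rw [vecs, unstep_massMat]
          exact hm i (by omega)
      · have a0 := hm0 0
        have a1 := hm0 1
        have a2 := hm0 2
        have hk1 : (1 : ℝ) ≤ k 0 := by exact_mod_cast hk 0
        simp only [Pi.zero_apply] at a0 a1 a2
        rw [massMat_mulVec]
        simp only [Fin.sum_univ_three] at hpos ⊢
        simp
        nlinarith
  refine ⟨(∑ i, m i)⁻¹ • m, fun i hi => ?_, ?_⟩
  · rw [vecs_smul]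
    exact smul_nonneg (inv_nonneg.2 hpos.le) (hm i hi)
  · simp only [Pi.smul_apply, smul_eq_mul, ← Finset.mul_sum]
    exact inv_mul_cancel₀ hpos.ne'

/-- Nested compactness, in the form needed for both existence and uniqueness of mass vectors. -/
theorem exists_mem_massVectors_prod {k : ℕ → ℕ} {C : Set ((Fin 3 → ℝ) × (Fin 3 → ℝ))}
    (hC : IsClosed C) (h : ∀ n, ((massVectorsUpTo k n ×ˢ massVectorsUpTo k n) ∩ C).Nonempty) :
    ((massVectors k ×ˢ massVectors k) ∩ C).Nonempty := by
  have hcomp : ∀ n, IsCompact ((massVectorsUpTo k n ×ˢ massVectorsUpTo k n) ∩ C) := fun n =>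
    ((isCompact_massVectorsUpTo k n).prod (isCompact_massVectorsUpTo k n)).inter_right hC
  obtain ⟨z, hz⟩ := IsCompact.nonempty_iInter_of_sequence_nonempty_isCompact_isClosed _
    (fun n => inter_subset_inter_left C (prod_mono (massVectorsUpTo_anti k n.le_succ)
      (massVectorsUpTo_anti k n.le_succ))) h (hcomp 0) fun n => (hcomp n).isClosed
  rw [mem_iInter] at hz
  exact ⟨z, ⟨⟨fun n => (hz n).1.1.1 n le_rfl, (hz 0).1.1.2⟩,
    ⟨fun n => (hz n).1.2.1 n le_rfl, (hz 0).1.2.2⟩⟩, (hz 0).2⟩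

theorem massVectors_nonempty {k : ℕ → ℕ} (hk : ∀ n, 1 ≤ k n) : (massVectors k).Nonempty := by
  obtain ⟨z, hz, -⟩ := exists_mem_massVectors_prod (k := k) isClosed_univ fun n => by
    rw [inter_univ]
    exact (massVectorsUpTo_nonempty hk n).prod (massVectorsUpTo_nonempty hk n)
  exact ⟨z.1, hz.1⟩

/-- Uniqueness of the mass vector is detected by the finite approximations, up to each precision. -/
theorem existsUnique_massVectors_iff {k : ℕ → ℕ} (hk : ∀ n, 1 ≤ k n) :
    (∃! m, m ∈ massVectors k) ↔ ∀ j : ℕ, ∃ n, ∀ m ∈ massVectorsUpTo k n,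
      ∀ m' ∈ massVectorsUpTo k n, dist m m' < 1 / ((j : ℝ) + 1) := by
  constructor
  · rintro ⟨m₀, -, huniq⟩ j
    by_contra! hcon
    obtain ⟨z, hz, hdist⟩ := exists_mem_massVectors_prod (k := k)
      (C := {z | 1 / ((j : ℝ) + 1) ≤ dist z.1 z.2})
      (isClosed_le continuous_const (by fun_prop)) fun n => by
        obtain ⟨m, hm, m', hm', h⟩ := hcon n
        exact ⟨(m, m'), ⟨hm, hm'⟩, h⟩
    have : 0 < 1 / ((j : ℝ) + 1) := by positivity
    rw [mem_ofPred_eq, huniq _ hz.1, huniq _ hz.2, dist_self] at hdist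
    linarith
  · intro h
    obtain ⟨m, hm⟩ := massVectors_nonempty hk
    refine ⟨m, hm, fun m' hm' => ?_⟩
    by_contra hne
    obtain ⟨j, hj⟩ := exists_nat_one_div_lt (dist_pos.2 hne)
    obtain ⟨n, hn⟩ := h j
    have := hn m' ⟨fun i _ => hm'.1 i, hm'.2⟩ m ⟨fun i _ => hm.1 i, hm.2⟩
    linarith

theorem one_le_digits {p : ℝ × ℝ} (hp : p ∈ A) (n : ℕ) : 1 ≤ digits p n :=
  (renorm_of_mem_A (iterate_G_mem_A hp n)).one_le

theorem mem_AUE_iff {p : ℝ × ℝ} (hp : p ∈ A) : p ∈ AUE ↔ ∃! m, m ∈ massVectors (digits p) := by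
  rw [← uniquelyErgodic_iff hp]
  exact ⟨fun h => h.2, fun h => ⟨hp, h⟩⟩

theorem exists_isGδ_AUE_eq : ∃ W : Set (ℝ × ℝ), IsGδ W ∧ AUE = A ∩ W := by
  refine ⟨⋂ j : ℕ, interior {p | ∃ n, ∀ m ∈ massVectorsUpTo (digits p) n,
      ∀ m' ∈ massVectorsUpTo (digits p) n, dist m m' < 1 / ((j : ℝ) + 1)},
    IsGδ.iInter_of_isOpen fun j => isOpen_interior, ?_⟩
  ext p
  constructor
  · intro h
    have hp : p ∈ A := h.1
    refine ⟨hp, mem_iInter.2 fun j => ?_⟩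
    obtain ⟨n, hn⟩ := (existsUnique_massVectors_iff (one_le_digits hp)).1 ((mem_AUE_iff hp).1 h) j
    rw [mem_interior_iff_mem_nhds]
    filter_upwards [eventually_digits_eq hp n] with q hq
    refine ⟨n, ?_⟩
    rwa [massVectorsUpTo_congr hq]
  · rintro ⟨hp, h⟩
    rw [mem_AUE_iff hp, existsUnique_massVectors_iff (one_le_digits hp)]
    intro j
    have hj := interior_subset (mem_iInter.1 h j)
    exact hj

/-! ### Density of the uniquely ergodic parameters -/

/-- The third power of `massMat 2` has positive entries, all at most `5`. -/
theorem balancedBlock_massMat {k : ℕ → ℕ} {n : ℕ} (h0 : k n = 2) (h1 : k (n + 1) = 2)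
    (h2 : k (n + 2) = 2) : BalancedBlock (fun n => massMat (k n)) (5 ^ 2) n (n + 3) := by
  refine ⟨by omega, ?_⟩
  have key : ∀ u : ℕ → Fin 3 → ℝ, RecTo (fun n => massMat (k n)) (n + 3) u → 0 ≤ u (n + 3) →
      0 ≤ ∑ i, u (n + 3) i ∧ ∀ i, (1 : Fin 3 → ℝ) i * (∑ i, u (n + 3) i) ≤ u n i ∧
        u n i ≤ 5 * ((1 : Fin 3 → ℝ) i * (∑ i, u (n + 3) i)) := by
    intro u hu hpos
    have e1 := hu n (by omega)
    have e2 := hu (n + 1) (by omega)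
    have e3 := hu (n + 2) (by omega)
    rw [show n + 1 + 1 = n + 2 by ring] at e2
    rw [show n + 2 + 1 = n + 3 by ring] at e3
    rw [e2, e3] at e1
    simp only [h0, h1, h2, massMat_mulVec] at e1
    have b0 := hpos 0
    have b1 := hpos 1
    have b2 := hpos 2
    simp only [Pi.zero_apply] at b0 b1 b2
    simp only [Fin.sum_univ_three]
    refine ⟨by linarith, fun i => ?_⟩
    rw [e1]
    fin_cases i <;> simp <;> constructor <;> linarith
  intro u v hu hv hu0 hv0 i j
  obtain ⟨a0, au⟩ := key u hu hu0
  obtain ⟨c0, cv⟩ := key v hv hv0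
  exact mul_le_of_profile (fun _ => zero_le_one) a0 c0 (by norm_num) au cv i j

theorem mem_AUE_of_digits_eq_two {p : ℝ × ℝ} (hp : p ∈ A) {N : ℕ}
    (h : ∀ i, N ≤ i → digits p i = 2) : p ∈ AUE := by
  rw [mem_AUE_iff hp]
  obtain ⟨m, hm⟩ := massVectors_nonempty (one_le_digits hp)
  refine ⟨m, hm, fun m' hm' => ?_⟩
  ext i
  refine eq_of_forall_dist_le fun ε hε => ?_
  obtain ⟨L, hL⟩ := exists_forall_abs_sub_le (M := fun n => massMat (digits p n)) (C := 5 ^ 2)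
    (fun n => massMat_nonneg (one_le_digits hp n)) (by norm_num)
    (fun n => ⟨max n N, _, le_max_left _ _, balancedBlock_massMat (h _ (by omega))
      (h _ (by omega)) (h _ (by omega))⟩) hε
  exact hL (vecs (digits p) m') (vecs (digits p) m) (fun n _ => vecs_eq_mulVec _ _ n)
    (fun n _ => vecs_eq_mulVec _ _ n) (hm'.1 L) (hm.1 L) hm'.2 hm.2 i

theorem injOn_digits : InjOn digits A := by
  intro p hp q hq h
  refine eq_of_forall_dist_le fun ε hε => ?_
  obtain ⟨N, hN⟩ := exists_forall_dist_lt hq hε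
  exact (hN p hp fun i _ => congrFun h i).le

/-- The infinite type parameters whose partial quotients are those of a point of `K` up to index
`n`, and `2` from then on. -/
def truncations (K : Set (ℝ × ℝ)) (n : ℕ) : Set (ℝ × ℝ) :=
  {q | q ∈ A ∧ ∃ p ∈ K, digits q = fun i => if i < n then digits p i else 2}

theorem digits_eq_of_mem_truncations {K : Set (ℝ × ℝ)} {n : ℕ} {q : ℝ × ℝ}
    (h : q ∈ truncations K n) : ∃ p ∈ K, ∀ i < n, digits q i = digits p i := by
  obtain ⟨-, p, hp, h⟩ := h
  exact ⟨p, hp, fun i hi => by rw [h]; simp [hi]⟩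

theorem truncations_subset_AUE (K : Set (ℝ × ℝ)) (n : ℕ) : truncations K n ⊆ AUE := by
  rintro q ⟨hq, p, -, h⟩
  exact mem_AUE_of_digits_eq_two hq (N := n) fun i hi => by rw [h]; simp [hi]

theorem exists_mem_truncations {K : Set (ℝ × ℝ)} (hK : K ⊆ A) {p : ℝ × ℝ} (hp : p ∈ K) (n : ℕ) :
    ∃ q ∈ truncations K n, ∀ i < n, digits q i = digits p i := by
  obtain ⟨q, hq, h1, h2⟩ := exists_digits_eq_two_from (hK hp) n
  refine ⟨q, ⟨hq, p, hp, ?_⟩, h1⟩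
  ext i
  split_ifs with hi
  · exact h1 i hi
  · exact h2 i (not_lt.1 hi)

theorem finite_truncations {K : Set (ℝ × ℝ)} (hK : IsCompact K) (hKA : K ⊆ A) (n : ℕ) :
    (truncations K n).Finite := by
  have hfin : ((fun p i => if i < n then digits p i else 2) '' K : Set (ℕ → ℕ)).Finite := by
    refine hK.induction_on (p := fun s => ((fun p i => if i < n then digits p i else 2) '' s :
      Set (ℕ → ℕ)).Finite) (by simp) (fun s t hst ht => ht.subset (image_mono hst))
      (fun s t hs ht => by rw [image_union]; exact hs.union ht) fun p hp => ?_
    refine ⟨_, mem_nhdsWithin_of_mem_nhds (eventually_digits_eq (hKA hp) n),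
      (finite_singleton fun i => if i < n then digits p i else 2).subset ?_⟩
    rintro _ ⟨q, hq, rfl⟩
    rw [mem_singleton_iff]
    ext i
    simp only
    split_ifs with hi
    · exact hq i hi
    · rfl
  refine Finite.of_finite_image (hfin.subset ?_) (injOn_digits.mono fun q hq => hq.1)
  rintro _ ⟨q, ⟨-, p, hp, h⟩, rfl⟩
  exact ⟨p, hp, h.symm⟩

theorem exists_forall_mem_of_isOpen {K V : Set (ℝ × ℝ)} (hK : IsCompact K) (hKA : K ⊆ A)
    (hV : IsOpen V) (hKV : K ⊆ V) :
    ∃ N, ∀ p ∈ K, ∀ q ∈ A, (∀ i < N, digits q i = digits p i) → q ∈ V := by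
  refine hK.induction_on (p := fun s => ∃ N, ∀ p ∈ s, ∀ q ∈ A,
    (∀ i < N, digits q i = digits p i) → q ∈ V) ⟨0, by simp⟩ ?_ ?_ fun p hp => ?_
  · rintro s t hst ⟨N, hN⟩
    exact ⟨N, fun p hp => hN p (hst hp)⟩
  · rintro s t ⟨N, hN⟩ ⟨L, hL⟩
    refine ⟨max N L, fun p hp q hq h => ?_⟩
    rcases hp with hp | hp
    · exact hN p hp q hq fun i hi => h i (by omega)
    · exact hL p hp q hq fun i hi => h i (by omega)
  · obtain ⟨ε, hε, hball⟩ := Metric.isOpen_iff.1 hV p (hKV hp)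
    obtain ⟨N, hN⟩ := exists_forall_dist_lt (hKA hp) hε
    refine ⟨_, mem_nhdsWithin_of_mem_nhds (eventually_digits_eq (hKA hp) N), N,
      fun p' hp' q hq h => hball (hN q hq fun i hi => ?_)⟩
    rw [h i hi]
    exact hp' i hi

/-- Adding to a compact set a set that accumulates only on it gives a compact set. -/
theorem isCompact_union_of_finite_diff {X : Type*} [TopologicalSpace X] {K F : Set X}
    (hK : IsCompact K) (h : ∀ V, IsOpen V → K ⊆ V → (F \ V).Finite) : IsCompact (K ∪ F) := by
  classical
  refine isCompact_of_finite_subcover fun {ι} O hO hcover => ?_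
  obtain ⟨t, ht⟩ := hK.elim_finite_subcover O hO (subset_union_left.trans hcover)
  have hfin := h (⋃ i ∈ t, O i) (isOpen_biUnion fun i _ => hO i) ht
  obtain ⟨t', ht'⟩ := hfin.isCompact.elim_finite_subcover O hO
    ((sdiff_subset.trans subset_union_right).trans hcover)
  refine ⟨t ∪ t', fun x hx => ?_⟩
  rw [Finset.set_biUnion_union]
  by_cases hxt : x ∈ ⋃ i ∈ t, O i
  · exact Or.inl hxt
  · rcases hx with hx | hx
    · exact absurd (ht hx) hxt
    · exact Or.inr (ht' ⟨hx, hxt⟩)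

theorem isCompact_union_truncations {K : Set (ℝ × ℝ)} (hK : IsCompact K) (hKA : K ⊆ A) :
    IsCompact (K ∪ ⋃ n, truncations K n) := by
  refine isCompact_union_of_finite_diff hK fun V hV hKV => ?_
  obtain ⟨N, hN⟩ := exists_forall_mem_of_isOpen hK hKA hV hKV
  refine ((finite_lt_nat N).biUnion fun n _ => finite_truncations hK hKA n).subset ?_
  rintro q ⟨hq, hqV⟩
  obtain ⟨n, hn⟩ := mem_iUnion.1 hq
  refine mem_biUnion (x := n) ?_ hn
  by_contra hlt
  obtain ⟨p, hp, h⟩ := digits_eq_of_mem_truncations hn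
  exact hqV (hN p hp q hn.1 fun i hi => h i (hi.trans_le (not_lt.1 hlt)))

theorem exists_mem_truncations_dist_lt {K : Set (ℝ × ℝ)} (hK : K ⊆ A) {p : ℝ × ℝ} (hp : p ∈ K)
    {ε : ℝ} (hε : 0 < ε) : ∃ n, ∃ q ∈ truncations K n, dist q p < ε := by
  obtain ⟨N, hN⟩ := exists_forall_dist_lt (hK hp) hε
  obtain ⟨q, hq, h⟩ := exists_mem_truncations hK hp N
  exact ⟨N, q, hq, hN q hq.1 h⟩

end ITM

end

theorem corollary2p13 :
    -- the set of uniquely ergodic parameters is a dense Gδ in the subspace `A`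
    (IsGδ ((↑) ⁻¹' ITM.AUE : Set ↥ITM.A) ∧ Dense ((↑) ⁻¹' ITM.AUE : Set ↥ITM.A)) ∧
    -- its trace on every compact subset of `A` is a Gδ
    (∀ K : Set (ℝ × ℝ), IsCompact K → K ⊆ ITM.A → IsGδ (ITM.AUE ∩ K)) ∧
    -- every compact subset of `A` lies in a compact subset of `A` in which the trace is dense
    (∀ K₀ : Set (ℝ × ℝ), IsCompact K₀ → K₀ ⊆ ITM.A →
      ∃ K : Set (ℝ × ℝ), IsCompact K ∧ K₀ ⊆ K ∧ K ⊆ ITM.A ∧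
        Dense ((↑) ⁻¹' ITM.AUE : Set ↥K)) := by
  obtain ⟨W, hW, hAW⟩ := ITM.exists_isGδ_AUE_eq
  refine ⟨⟨?_, ?_⟩, fun K hK hKA => ?_, fun K hK hKA => ?_⟩
  · have : ((↑) ⁻¹' ITM.AUE : Set ↥ITM.A) = (↑) ⁻¹' W := by
      ext p
      simp [hAW]
    rw [this]
    exact hW.preimage continuous_subtype_val
  · refine Metric.dense_iff.2 fun p ε hε => ?_
    obtain ⟨n, q, hq, hdist⟩ := ITM.exists_mem_truncations_dist_lt subset_rfl p.2 hε
    exact ⟨⟨q, hq.1⟩, hdist, ITM.truncations_subset_AUE _ n hq⟩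
  · have : ITM.AUE ∩ K = W ∩ K := by
      rw [hAW]
      ext p
      exact ⟨fun h => ⟨h.1.2, h.2⟩, fun h => ⟨⟨hKA h.2, h.1⟩, h.2⟩⟩
    rw [this]
    exact hW.inter hK.isClosed.isGδ
  · refine ⟨_, ITM.isCompact_union_truncations hK hKA, subset_union_left,
      union_subset hKA (iUnion_subset fun n q hq => hq.1), Metric.dense_iff.2 ?_⟩
    rintro ⟨p, hp | hp⟩ ε hε
    · obtain ⟨n, q, hq, hdist⟩ := ITM.exists_mem_truncations_dist_lt hKA hp hε
      exact ⟨⟨q, Or.inr (mem_iUnion.2 ⟨n, hq⟩)⟩, hdist, ITM.truncations_subset_AUE _ n hq⟩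
    · obtain ⟨n, hn⟩ := mem_iUnion.1 hp
      exact ⟨⟨p, Or.inr hp⟩, Metric.mem_ball_self hε, ITM.truncations_subset_AUE _ n hn⟩
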